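/- **Setting.** A recursive large-flow detector (RLFD) has $d$ levels and $m$ counters. The link carries $n$ legitimate flows and one attack flow. A detection cycle consists of $d$ periods of length $T$. The attack flow is flat: in every period it sends the volume $\alpha\gamma T$, where $\gamma>0$ is the threshold rate and $\alpha>1$. In each period every legitimate flow has a rate in $[0,\gamma]$, and the legitimate rates sum to at most the link rate $\rho$; otherwise the legitimate traffic is arbitrary. Put $n_\gamma=\rho/\gamma$. Every flow is hashed, independently and uniformly, to a path in the full $m$-ary tree of depth $d$. In period $k<d$ the detector loads the node reached so far (the root for $k=1$); each of its $m$ child counters receives the traffic of the flows whose path goes through it, and the detector moves to a child with the largest counter value. In period $d$ the flows hashed to the reached node are given dedicated counters (if there are more than $m$ of them, a uniformly random choice of $m$ of them is). The attack flow is caught if it gets a dedicated counter in period $d$ and its volume there exceeds $\gamma T+\beta$, where $\beta\ge 0$. Let $\Pr(A_\alpha)$ be the probability that it is caught in one cycle, for the worst way of breaking ties among largest counters. For real $x$ let $Q(x,\lambda)$ be the cumulative distribution function of the Poisson distribution with mean $\lambda$, at $x$. For $c\ge 1$ let $$K^{c}(N)=\Big\lfloor \tfrac{N}{m}+c\sqrt{2\tfrac{N}{m}\log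 N}-\alpha\Big\rfloor ,\qquad B^{c}=\begin{cases}\Big(1-Q\big(K^{c}(n_\gamma),\tfrac{n_\gamma}{m}\big)\Big)^{\lfloor\log_m(n/n_\gamma)\rfloor+1}, & n\ge n_\gamma,\\[1ex] 1-Q\big(K^{c}(n),\tfrac{n}{m}\big), & n<n_\gamma.\end{cases}$$ **Theorem (total detection probability).** For all reals $b$, $c>1$ and $\varepsilon>0$ there is a constant $C$ such that, for all $m,n,d,\gamma,\rho,\beta,T,\alpha$ and all legitimate traffic as above with $m\ge C$, $d\ge\lceil\log_m n\rceil$ and $\beta\le b\,\gamma T$: 1. if $\min(n,n_\gamma)\ge C\,m(\log m)^3$, then $\Pr(A_\alpha)\ge B^{1}-\varepsilon$; 2. if $\min(n,n_\gamma)\ge C\,m\log m$, then $\Pr(A_\alpha)\ge B^{c}-\varepsilon$. That is, $B^1$ is an approximate lower bound of the total detection probability for a large number of counters and a number of flows that is large compared with $m$. -/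

import Mathlib

namespace RLFD

/-- The flows on the link during one detection cycle: the attack flow `none` and the `n`
legitimate flows `some i`. -/
abbrev Flow (n : ℕ) : Type := Option (Fin n)

/-- Admissible legitimate traffic for a detector with `d` levels: `r k i` is the rate of the
legitimate flow `i` during the `k`-th level period. No legitimate flow exceeds the threshold
rate `γ`, and in every period the legitimate flows together do not exceed the link rate `ρ`. -/
structure IsLegitimate {n d : ℕ} (γ ρ : ℝ) (r : Fin d → Fin n → ℝ) : Prop where
  nonneg : ∀ k i, 0 ≤ r k i
  le_threshold : ∀ k i, r k i ≤ γ
  sum_le_link : ∀ k, ∑ i, r k i ≤ ρ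

/-- Traffic volume sent by each flow in each level period, all periods having length `T`.
The attack flow is flat: it sends at the constant rate `α * γ`. -/
def volume {n d : ℕ} (γ α T : ℝ) (r : Fin d → Fin n → ℝ) (k : Fin d) : Flow n → ℝ
  | none => α * γ * T
  | some i => r k i * T

/-- The random choices of one detection cycle: each flow is hashed to a path of counters in
the virtual counter tree (one of `m` counters for each of the `d` levels), and the flows are
put in a random order, which decides who gets a counter of its own at the bottom level. -/
abbrev Randomness (n m d : ℕ) : Type :=
  (Flow n → Fin d → Fin m) × (Flow n ≃ Fin (n + 1))

open Classical in
/-- Value at the end of period `k` of counter `j` of the loaded counter array, if the counters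
selected in the earlier periods are `s i`, `i < k`: the total volume of the flows whose path
agrees with `s` above level `k` and continues with `j`. -/
noncomputable def counterValue {n m d : ℕ} (vol : Fin d → Flow n → ℝ)
    (path : Flow n → Fin d → Fin m) (s : Fin d → Fin m) (k : Fin d) (j : Fin m) : ℝ :=
  ∑ f : Flow n, if (∀ i < k, path f i = s i) ∧ path f k = j then vol k f else 0

/-- `s` is a possible sequence of selections: in every period except that of the bottom level,
a counter with the largest value is selected. (Ties may be broken in any way; the value of `s`
at the bottom level is irrelevant.) -/
def IsRun {n m d : ℕ} (vol : Fin d → Flow n → ℝ) (path : Flow n → Fin d → Fin m)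
    (s : Fin d → Fin m) : Prop :=
  ∀ k : Fin d, (k : ℕ) + 1 < d →
    ∀ j : Fin m, counterValue vol path s k j ≤ counterValue vol path s k (s k)

/-- The flows that are monitored at the bottom level under the selections `s`. -/
def bottomFlows {n m d : ℕ} (path : Flow n → Fin d → Fin m) (s : Fin d → Fin m) :
    Set (Flow n) :=
  {f | ∀ k : Fin d, (k : ℕ) + 1 < d → path f k = s k}

/-- The attack flow is caught in the cycle: however ties are broken, it belongs to the flows of
the bottom level, it is one of the (at most) `m` of these flows, picked at random, that get a
dedicated counter, and the volume in its counter exceeds the threshold `γ * T + β`. -/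
def Caught {n m d : ℕ} (γ β T α : ℝ) (r : Fin d → Fin n → ℝ) (ω : Randomness n m d) : Prop :=
  (∀ s : Fin d → Fin m, IsRun (volume γ α T r) ω.1 s →
    none ∈ bottomFlows ω.1 s ∧
    {f ∈ bottomFlows ω.1 s | ω.2 f < ω.2 none}.ncard < m) ∧
  γ * T + β < α * γ * T

/-- Total detection probability: the probability, under uniformly distributed random choices
(random oracle), that the attack flow is caught in one detection cycle. -/
noncomputable def detectionProb {n d : ℕ} (m : ℕ) (γ β T α : ℝ) (r : Fin d → Fin n → ℝ) : ℝ :=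
  ({ω : Randomness n m d | Caught γ β T α r ω}.ncard : ℝ) / Nat.card (Randomness n m d)

/-- `Q x l` is the cumulative distribution function of the Poisson distribution with mean `l`
at the point `x`. -/
noncomputable def Q (x l : ℝ) : ℝ :=
  (ProbabilityTheory.poissonMeasure l.toNNReal).real {k : ℕ | (k : ℝ) ≤ x}

/-- `⌊N / m + c * √(2 (N / m) log N) - α⌋`. -/
noncomputable def K (c : ℝ) (m : ℕ) (N α : ℝ) : ℤ :=
  ⌊N / m + c * √(2 * (N / m) * Real.log N) - α⌋

/-- The lower bound for the total detection probability, where `nγ` is the maximum number of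
legitimate flows at the threshold rate; `c` is the factor in front of the square root in `K`. -/
noncomputable def totalBound (c : ℝ) (m n : ℕ) (nγ α : ℝ) : ℝ :=
  if nγ ≤ n then
    (1 - Q (K c m nγ α) (nγ / m)) ^ (⌊Real.logb m (n / nγ)⌋₊ + 1)
  else
    1 - Q (K c m n α) (n / m)

end RLFD

/-!
The bound holds for the reason that only the first period matters.

Volumes are measured in units of `γ * T`, `N = min n (ρ / γ)` bounds the legitimate volume of
every period, `λ = N / m` is the load per counter and `t = √(2 λ log N)` the deviation of the
largest of the counters. The power in the bound only makes it smaller, so it is enough to compare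
the detection probability with a single Poisson tail, `P(Pois λ - λ > c t - α)`. If `α < 3 t / 4`,
this tail is small by Chebyshev's inequality (`poisson_tail_le_of_lt`). So `α ≥ 3 t / 4`, and in
particular the volume of the attack flow exceeds the threshold.

For a fixed path of the attack flow, the cycle can only fail if, in some node on this path, another
counter is as large as the one of the attack flow, or if the attack flow gets no dedicated counter
at the end. The events of different levels are compared along the fixed path, so a union bound
over the levels suffices and no conditioning on the outcome of earlier periods is needed
(`le_detectionProb`). Below the first period the traffic decreases geometrically, and Chebyshev's
inequality for differences of counters bounds the total failure probability by `4 λ / α ^ 2`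
(`prob_exists_not_wins_le`). At the bottom, at most `m` other flows are expected, and the random
order is symmetric, so the failure probability is `O(1 / √m)` (`prob_not_dedicated_le`).

In the first period, let `v` be the sum of the squares of the volumes, divided by `m`; it is about
the variance of a counter, and `v ≤ λ`. Bernstein's inequality (`IsIndicator.prob_lt_sum_le`)
bounds all counters by their mean plus `c √(2 v log N)`. If `v` is small compared with `λ`, the
attack flow wins with high probability (`one_le_prob_win_add`). Otherwise the traffic in its
counter, rescaled from variance `v` to variance `λ`, is compared with the Poisson distribution of
mean `λ`:
Lindeberg's method exchanges the weighted indicators one by one for small centred Poisson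
variables, whose sum is Poisson again (`TaylorBound.abs_expect_sum_sub_integral_poisson_le`). The
passage from smooth test functions to tails uses that Poisson distributions of large mean put
little mass on short intervals (`poisson_real_Ioo_le`, from Stirling's formula). The cubic error
term in Bernstein's exponent is of order `(log N) ^ (3 / 2) / √λ`; it is bounded if
`λ ≥ C (log m) ^ 3`, and for `λ ≥ C log m` it is absorbed by the factor `c > 1`.
-/

open scoped BigOperators

namespace RLFD

/-! ### Expectations and probabilities under uniform independent choices -/

section Uniform

variable {Ω Ω' G : Type*} [Fintype Ω] [Fintype Ω'] [Fintype G]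

open Classical in
/-- The probability of the event `A` under the uniform distribution on a finite type. -/
noncomputable def prob (A : Ω → Prop) : ℝ := 𝔼 ω, if A ω then (1 : ℝ) else 0

theorem expect_mono {f g : Ω → ℝ} (h : ∀ ω, f ω ≤ g ω) : 𝔼 ω, f ω ≤ 𝔼 ω, g ω :=
  Finset.expect_le_expect fun ω _ ↦ h ω

theorem prob_le_expect {A : Ω → Prop} {f : Ω → ℝ} (hf : ∀ ω, 0 ≤ f ω) (h : ∀ ω, A ω → 1 ≤ f ω) :
    prob A ≤ 𝔼 ω, f ω := by
  classical
  refine expect_mono fun ω ↦ ?_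
  split_ifs with hA
  exacts [h ω hA, hf ω]

theorem expect_le_prob {A : Ω → Prop} {f : Ω → ℝ} (hf : ∀ ω, f ω ≤ 1)
    (h : ∀ ω, ¬ A ω → f ω ≤ 0) : 𝔼 ω, f ω ≤ prob A := by
  classical
  refine expect_mono fun ω ↦ ?_
  split_ifs with hA
  exacts [hf ω, h ω hA]

theorem prob_nonneg (A : Ω → Prop) : 0 ≤ prob A :=
  Finset.expect_nonneg fun ω _ ↦ by split_ifs <;> norm_num

theorem prob_mono {A B : Ω → Prop} (h : ∀ ω, A ω → B ω) : prob A ≤ prob B := by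
  classical
  refine prob_le_expect (fun ω ↦ by split_ifs <;> norm_num) fun ω hA ↦ ?_
  rw [if_pos (h ω hA)]

theorem prob_or_le (A B : Ω → Prop) : prob (fun ω ↦ A ω ∨ B ω) ≤ prob A + prob B := by
  classical
  rw [prob, prob, prob, ← Finset.expect_add_distrib]
  refine expect_mono fun ω ↦ ?_
  by_cases hA : A ω <;> by_cases hB : B ω <;> simp [hA, hB]

theorem prob_exists_le {ι : Type*} (s : Finset ι) (A : ι → Ω → Prop) :
    prob (fun ω ↦ ∃ i ∈ s, A i ω) ≤ ∑ i ∈ s, prob (A i) := by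
  classical
  simp only [prob]
  rw [← Finset.expect_sum_comm]
  refine prob_le_expect (fun ω ↦ Finset.sum_nonneg fun i _ ↦ by split_ifs <;> norm_num) ?_
  rintro ω ⟨i, hi, hA⟩
  refine le_trans ?_ (Finset.single_le_sum (f := fun i ↦ if A i ω then (1 : ℝ) else 0)
    (fun i _ ↦ by split_ifs <;> norm_num) hi)
  rw [if_pos hA]

theorem prob_not [Nonempty Ω] (A : Ω → Prop) : prob (fun ω ↦ ¬ A ω) = 1 - prob A := by
  classical
  rw [prob, prob, eq_sub_iff_add_eq, ← Finset.expect_add_distrib, ← Fintype.expect_one (ι := Ω)]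
  refine Finset.expect_congr rfl fun ω _ ↦ ?_
  by_cases hA : A ω <;> simp [hA]

/-- Chebyshev's inequality, for a random variable that need not be centred. -/
theorem prob_le_expect_sq_div {A : Ω → Prop} {f : Ω → ℝ} {u : ℝ} (hu : 0 < u)
    (h : ∀ ω, A ω → u ≤ |f ω|) : prob A ≤ (𝔼 ω, f ω ^ 2) / u ^ 2 := by
  rw [Finset.expect_div]
  refine prob_le_expect (fun ω ↦ by positivity) fun ω hA ↦ ?_
  rw [one_le_div (by positivity), ← sq_abs (f ω)]
  exact pow_le_pow_left₀ hu.le (h ω hA) 2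

theorem prob_equiv (e : Ω ≃ Ω') (A : Ω' → Prop) : prob (fun ω ↦ A (e ω)) = prob A := by
  classical
  exact Fintype.expect_equiv e _ _ fun _ ↦ rfl

theorem prob_prod (A : Ω × Ω' → Prop) : prob A = 𝔼 ω, prob fun ω' ↦ A (ω, ω') := by
  classical
  rw [prob, ← Finset.univ_product_univ, Finset.expect_product]
  rfl

theorem prob_comp_fst [Nonempty Ω'] (A : Ω → Prop) :
    prob (fun ω : Ω × Ω' ↦ A ω.1) = prob A := by
  classical
  rw [prob_prod, prob]
  refine Finset.expect_congr rfl fun ω _ ↦ ?_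
  exact Fintype.expect_const (ι := Ω') (M := ℝ) (if A ω then 1 else 0)

theorem ncard_div_card (A : Ω → Prop) :
    ({ω | A ω}.ncard : ℝ) / Nat.card Ω = prob A := by
  classical
  rw [prob, Fintype.expect_eq_sum_div_card, Finset.sum_boole, Nat.card_eq_fintype_card,
    ← Set.ncard_coe_finset]
  simp

theorem expect_fin_cons {n : ℕ} (F : (Fin (n + 1) → G) → ℝ) :
    𝔼 H, F H = 𝔼 g, 𝔼 H : Fin n → G, F (Fin.cons g H) := by
  rw [← Finset.expect_product', Finset.univ_product_univ]
  exact (Fintype.expect_equiv (Fin.consEquiv fun _ ↦ G) _ _ fun _ ↦ rfl).symm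

theorem expect_prod_eq {n : ℕ} (u : Fin n → G → ℝ) :
    𝔼 H : Fin n → G, ∏ i, u i (H i) = ∏ i, 𝔼 g, u i g := by
  induction n with
  | zero => simp
  | succ n ih =>
    simp only [expect_fin_cons, Fin.prod_univ_succ, Fin.cons_zero, Fin.cons_succ,
      ← Finset.mul_expect, ih, ← Finset.expect_mul]

variable [Nonempty G]

theorem expect_sum_eq_zero {n : ℕ} (u : Fin n → G → ℝ) (hu : ∀ i, 𝔼 g, u i g = 0) :
    𝔼 H : Fin n → G, ∑ i, u i (H i) = 0 := by
  induction n with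
  | zero => simp
  | succ n ih =>
    simp only [expect_fin_cons, Fin.sum_univ_succ, Fin.cons_zero, Fin.cons_succ,
      Finset.expect_add_distrib, Fintype.expect_const, hu 0, ih _ fun i ↦ hu i.succ, add_zero]

/-- The variance of a sum of independent centred random variables. -/
theorem expect_sum_sq {n : ℕ} (u : Fin n → G → ℝ) (hu : ∀ i, 𝔼 g, u i g = 0) :
    𝔼 H : Fin n → G, (∑ i, u i (H i)) ^ 2 = ∑ i, 𝔼 g, u i g ^ 2 := by
  induction n with
  | zero => simp
  | succ n ih =>
    simp only [expect_fin_cons, Fin.sum_univ_succ, Fin.cons_zero, Fin.cons_succ, add_sq,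
      Finset.expect_add_distrib, Fintype.expect_const, ← Finset.mul_expect, ih _ fun i ↦ hu i.succ,
      expect_sum_eq_zero _ fun i ↦ hu i.succ, mul_zero, add_zero]

end Uniform

/-! ### Weighted sums of independent indicators -/

section Indicator

variable {G : Type*} [Fintype G]

/-- `I` is the indicator of an event of probability `p`. -/
structure IsIndicator (I : G → ℝ) (p : ℝ) : Prop where
  zero_or_one : ∀ g, I g = 0 ∨ I g = 1
  expect_eq : 𝔼 g, I g = p

namespace IsIndicator

variable {I : G → ℝ} {p : ℝ}

theorem nonneg (h : IsIndicator I p) : 0 ≤ p := by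
  rw [← h.expect_eq]
  exact Finset.expect_nonneg fun g _ ↦ by rcases h.zero_or_one g with h | h <;> simp [h]

variable [Nonempty G]

theorem le_one (h : IsIndicator I p) : p ≤ 1 := by
  rw [← h.expect_eq, ← Fintype.expect_one (ι := G) (M := ℝ)]
  exact expect_mono fun g ↦ by rcases h.zero_or_one g with h | h <;> simp [h]

/-- The expectation of any function of an indicator. -/
theorem expect_comp (h : IsIndicator I p) (F : ℝ → ℝ) :
    𝔼 g, F (I g) = (1 - p) * F 0 + p * F 1 := by
  have : ∀ g, F (I g) = F 0 + I g * (F 1 - F 0) := fun g ↦ by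
    rcases h.zero_or_one g with h | h <;> simp [h]
  simp only [this, Finset.expect_add_distrib, Fintype.expect_const, ← Finset.expect_mul,
    h.expect_eq]
  ring

theorem expect_centred (h : IsIndicator I p) (a : ℝ) : 𝔼 g, a * (I g - p) = 0 := by
  rw [h.expect_comp fun y ↦ a * (y - p)]
  ring

theorem expect_centred_sq (h : IsIndicator I p) (a : ℝ) :
    𝔼 g, (a * (I g - p)) ^ 2 = a ^ 2 * p * (1 - p) := by
  rw [h.expect_comp fun y ↦ (a * (y - p)) ^ 2]
  ring

theorem expect_sum_sq_le (h : IsIndicator I p) {n : ℕ} (x : Fin n → ℝ) :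
    𝔼 H : Fin n → G, (∑ i, x i * (I (H i) - p)) ^ 2 ≤ p * ∑ i, x i ^ 2 := by
  rw [expect_sum_sq _ fun i ↦ h.expect_centred (x i), Finset.mul_sum]
  refine Finset.sum_le_sum fun i _ ↦ ?_
  rw [h.expect_centred_sq]
  nlinarith [mul_nonneg (sq_nonneg (x i)) (sq_nonneg p)]

theorem expect_exp_le (h : IsIndicator I p) {s x : ℝ} (hs : 0 ≤ s) (hs1 : s ≤ 1) (hx : 0 ≤ x)
    (hx1 : x ≤ 1) :
    𝔼 g, Real.exp (s * (x * (I g - p))) ≤ Real.exp (p * x ^ 2 * (s ^ 2 * (1 / 2 + s / 4))) := by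
  have hp := h.nonneg
  rw [h.expect_comp fun y ↦ Real.exp (s * (x * (y - p)))]
  set y := s * x with hy
  have hy0 : 0 ≤ y := mul_nonneg hs hx
  have hys : y ≤ s := mul_le_of_le_one_right hs hx1
  have hexp : Real.exp y - 1 - y ≤ y ^ 2 * (1 / 2 + s / 4) := by
    have := Real.exp_bound' hy0 (hys.trans hs1) (n := 3) (by norm_num)
    norm_num [Finset.sum_range_succ, Nat.factorial] at this
    nlinarith [mul_nonneg (sq_nonneg y) (sub_nonneg.2 hys), mul_nonneg (sq_nonneg y) hy0]
  calc (1 - p) * Real.exp (s * (x * (0 - p))) + p * Real.exp (s * (x * (1 - p)))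
      = (p * (Real.exp y - 1) + 1) * Real.exp (-(p * y)) := by
        rw [show s * (x * (1 - p)) = y + -(p * y) by rw [hy]; ring,
          show s * (x * (0 - p)) = -(p * y) by rw [hy]; ring, Real.exp_add]
        ring
    _ ≤ Real.exp (p * (Real.exp y - 1)) * Real.exp (-(p * y)) := by
        gcongr
        exact Real.add_one_le_exp _
    _ = Real.exp (p * (Real.exp y - 1 - y)) := by rw [← Real.exp_add]; ring_nf
    _ ≤ Real.exp (p * (y ^ 2 * (1 / 2 + s / 4))) := by gcongr
    _ = _ := by rw [hy]; ring_nf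

/-- Bernstein's inequality before the choice of the parameter `s`. -/
theorem prob_lt_sum_le (h : IsIndicator I p) {n : ℕ} {x : Fin n → ℝ} (hx : ∀ i, 0 ≤ x i)
    (hx1 : ∀ i, x i ≤ 1) {s : ℝ} (hs : 0 ≤ s) (hs1 : s ≤ 1) (U : ℝ) :
    prob (fun H : Fin n → G ↦ U < ∑ i, x i * (I (H i) - p)) ≤
      Real.exp (-(s * U) + (p * ∑ i, x i ^ 2) * (s ^ 2 * (1 / 2 + s / 4))) := by
  calc prob (fun H : Fin n → G ↦ U < ∑ i, x i * (I (H i) - p))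
      ≤ 𝔼 H : Fin n → G, Real.exp (-(s * U)) * ∏ i, Real.exp (s * (x i * (I (H i) - p))) := by
        refine prob_le_expect (fun H ↦ by positivity) fun H hH ↦ ?_
        rw [← Real.exp_sum, ← Real.exp_add, Real.one_le_exp_iff, ← Finset.mul_sum]
        nlinarith
    _ = Real.exp (-(s * U)) * ∏ i, 𝔼 g, Real.exp (s * (x i * (I g - p))) := by
        rw [← Finset.mul_expect, expect_prod_eq fun i g ↦ Real.exp (s * (x i * (I g - p)))]
    _ ≤ Real.exp (-(s * U)) * ∏ i, Real.exp (p * x i ^ 2 * (s ^ 2 * (1 / 2 + s / 4))) := by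
        gcongr with i
        exact h.expect_exp_le hs hs1 (hx i) (hx1 i)
    _ = _ := by rw [← Real.exp_sum, ← Real.exp_add, Finset.mul_sum, Finset.sum_mul]

end IsIndicator

end Indicator

/-! ### The Poisson distribution -/

section Poisson

open MeasureTheory ProbabilityTheory
open scoped NNReal Nat

theorem integrable_poisson_of_bound (θ : ℝ≥0) {F : ℕ → ℝ} {B : ℝ} (h : ∀ k, |F k| ≤ B) :
    Integrable F (poissonMeasure θ) :=
  Integrable.of_bound Measurable.of_discrete.aestronglyMeasurable B (.of_forall h)

/-- The Stein–Chen identity, which computes the moments of the Poisson distribution. -/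
theorem integral_natCast_mul_poisson (θ : ℝ≥0) {F : ℕ → ℝ}
    (hF : Integrable (fun k ↦ F (k + 1)) (poissonMeasure θ)) :
    Integrable (fun k : ℕ ↦ (k : ℝ) * F k) (poissonMeasure θ) ∧
      ∫ k, (k : ℝ) * F k ∂poissonMeasure θ = θ * ∫ k, F (k + 1) ∂poissonMeasure θ := by
  have key : ∀ k : ℕ, Real.exp (-θ) * (θ : ℝ) ^ (k + 1) / (k + 1)! * ((k + 1 : ℕ) : ℝ) =
      θ * (Real.exp (-θ) * (θ : ℝ) ^ k / k !) := fun k ↦ by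
    rw [Nat.factorial_succ]
    push_cast
    field_simp
    ring
  have hint : Integrable (fun k : ℕ ↦ (k : ℝ) * F k) (poissonMeasure θ) := by
    rw [integrable_poissonMeasure_iff] at hF ⊢
    rw [← summable_nat_add_iff 1]
    refine (hF.mul_left (θ : ℝ)).congr fun k ↦ ?_
    rw [norm_mul, ← mul_assoc, ← mul_assoc, ← key, Real.norm_natCast]
  refine ⟨hint, ?_⟩
  have h1 := hasSum_integral_poissonMeasure hint
  have h2 := (hasSum_integral_poissonMeasure hF).mul_left (θ : ℝ)
  rw [← hasSum_nat_add_iff' 1] at h1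
  simp only [Finset.range_one, Finset.sum_singleton, smul_eq_mul, Nat.cast_zero, zero_mul,
    mul_zero, sub_zero] at h1 h2
  refine h1.unique (h2.congr_fun fun k ↦ ?_)
  rw [← mul_assoc, ← mul_assoc, key]

theorem integral_poisson_id (θ : ℝ≥0) :
    Integrable (fun k : ℕ ↦ (k : ℝ)) (poissonMeasure θ) ∧
      ∫ k, (k : ℝ) ∂poissonMeasure θ = θ := by
  simpa using integral_natCast_mul_poisson θ (F := fun _ ↦ 1) (integrable_const 1)

theorem integral_poisson_sq (θ : ℝ≥0) :
    Integrable (fun k : ℕ ↦ (k : ℝ) ^ 2) (poissonMeasure θ) ∧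
      ∫ k, (k : ℝ) ^ 2 ∂poissonMeasure θ = (θ : ℝ) ^ 2 + θ := by
  obtain ⟨h1, e1⟩ := integral_poisson_id θ
  have h2 : Integrable (fun k : ℕ ↦ ((k + 1 : ℕ) : ℝ)) (poissonMeasure θ) := by
    simpa using h1.add (integrable_const 1)
  obtain ⟨h, e⟩ := integral_natCast_mul_poisson θ (F := fun k ↦ (k : ℝ)) h2
  simp only [Nat.cast_add, Nat.cast_one, ← sq] at h e
  refine ⟨h, ?_⟩
  rw [e, integral_add h1 (integrable_const 1), e1]
  simp
  ring

theorem integral_poisson_cube (θ : ℝ≥0) :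
    Integrable (fun k : ℕ ↦ (k : ℝ) ^ 3) (poissonMeasure θ) ∧
      ∫ k, (k : ℝ) ^ 3 ∂poissonMeasure θ = (θ : ℝ) ^ 3 + 3 * θ ^ 2 + θ := by
  obtain ⟨h1, e1⟩ := integral_poisson_id θ
  obtain ⟨h2, e2⟩ := integral_poisson_sq θ
  have hexp : ∀ k : ℕ, ((k + 1 : ℕ) : ℝ) ^ 2 = (k : ℝ) ^ 2 + (2 * k + 1) := fun k ↦ by
    push_cast
    ring
  have h3 : Integrable (fun k : ℕ ↦ 2 * (k : ℝ) + 1) (poissonMeasure θ) :=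
    (h1.const_mul 2).add (integrable_const 1)
  have h4 : Integrable (fun k : ℕ ↦ ((k + 1 : ℕ) : ℝ) ^ 2) (poissonMeasure θ) := by
    simp only [hexp]
    exact h2.add h3
  obtain ⟨h, e⟩ := integral_natCast_mul_poisson θ (F := fun k ↦ (k : ℝ) ^ 2) h4
  have hcube : ∀ k : ℕ, (k : ℝ) * (k : ℝ) ^ 2 = (k : ℝ) ^ 3 := fun k ↦ by ring
  simp only [hcube, hexp] at h e
  refine ⟨h, ?_⟩
  rw [e, integral_add h2 h3, integral_add (h1.const_mul 2) (integrable_const 1), e2,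
    integral_const_mul, e1]
  simp
  ring

theorem integral_poisson_centred (θ : ℝ≥0) :
    Integrable (fun k : ℕ ↦ (k : ℝ) - θ) (poissonMeasure θ) ∧
      ∫ k, ((k : ℝ) - θ) ∂poissonMeasure θ = 0 := by
  obtain ⟨h1, e1⟩ := integral_poisson_id θ
  refine ⟨h1.sub (integrable_const _), ?_⟩
  rw [integral_sub h1 (integrable_const _), e1]
  simp

theorem integral_poisson_centred_sq (θ : ℝ≥0) :
    Integrable (fun k : ℕ ↦ ((k : ℝ) - θ) ^ 2) (poissonMeasure θ) ∧
      ∫ k, ((k : ℝ) - θ) ^ 2 ∂poissonMeasure θ = θ := by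
  obtain ⟨h1, e1⟩ := integral_poisson_id θ
  obtain ⟨h2, e2⟩ := integral_poisson_sq θ
  have hexp : ∀ k : ℕ, ((k : ℝ) - θ) ^ 2 = (k : ℝ) ^ 2 - (2 * θ * k - (θ : ℝ) ^ 2) := fun k ↦ by
    ring
  have h3 : Integrable (fun k : ℕ ↦ 2 * (θ : ℝ) * k - (θ : ℝ) ^ 2) (poissonMeasure θ) :=
    (h1.const_mul _).sub (integrable_const _)
  simp only [hexp]
  refine ⟨h2.sub h3, ?_⟩
  rw [integral_sub h2 h3, integral_sub (h1.const_mul _) (integrable_const _), e2,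
    integral_const_mul, e1]
  simp
  ring

/-- A third absolute moment of order `θ`, the reason why Poisson variables of small mean can
replace indicators in the Lindeberg argument. -/
theorem integral_poisson_abs_cube_le (θ : ℝ≥0) (hθ : θ ≤ 1) :
    Integrable (fun k : ℕ ↦ |(k : ℝ) - θ| ^ 3) (poissonMeasure θ) ∧
      ∫ k, |(k : ℝ) - θ| ^ 3 ∂poissonMeasure θ ≤ 6 * θ := by
  obtain ⟨h3, e3⟩ := integral_poisson_cube θ
  have hθ0 : (0 : ℝ) ≤ θ := θ.2
  have hθ1 : (θ : ℝ) ≤ 1 := hθ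
  have hb : ∀ k : ℕ, |(k : ℝ) - θ| ^ 3 ≤ (k : ℝ) ^ 3 + θ := fun k ↦ by
    rcases Nat.eq_zero_or_pos k with rfl | hk
    · simp only [Nat.cast_zero, zero_sub, abs_neg, abs_of_nonneg hθ0]
      nlinarith [mul_nonneg hθ0 (sub_nonneg.2 hθ1), mul_nonneg (sq_nonneg (θ : ℝ))
        (sub_nonneg.2 hθ1)]
    · have hk1 : (1 : ℝ) ≤ k := by exact_mod_cast hk
      have : |(k : ℝ) - θ| ≤ k := by rw [abs_le]; constructor <;> linarith
      have := pow_le_pow_left₀ (abs_nonneg _) this 3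
      linarith
  have hi : Integrable (fun k : ℕ ↦ (k : ℝ) ^ 3 + θ) (poissonMeasure θ) :=
    h3.add (integrable_const _)
  have hi' : Integrable (fun k : ℕ ↦ |(k : ℝ) - θ| ^ 3) (poissonMeasure θ) :=
    hi.mono' Measurable.of_discrete.aestronglyMeasurable (.of_forall fun k ↦ by
      rw [Real.norm_of_nonneg (by positivity)]
      exact hb k)
  refine ⟨hi', (integral_mono hi' hi hb).trans ?_⟩
  rw [integral_add h3 (integrable_const _), e3]
  simp
  nlinarith [mul_nonneg hθ0 (sub_nonneg.2 hθ1), mul_nonneg (sq_nonneg (θ : ℝ))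
        (sub_nonneg.2 hθ1)]

theorem integral_poisson_add (θ₁ θ₂ : ℝ≥0) {F : ℕ → ℝ} {B : ℝ} (h : ∀ k, |F k| ≤ B) :
    ∫ k, F k ∂poissonMeasure (θ₁ + θ₂) =
      ∫ k, ∫ l, F (k + l) ∂poissonMeasure θ₂ ∂poissonMeasure θ₁ := by
  rw [← poissonMeasure_conv_poissonMeasure, integral_conv]
  rw [poissonMeasure_conv_poissonMeasure]
  exact integrable_poisson_of_bound _ h

/-- Chebyshev's inequality for the Poisson distribution. -/
theorem poisson_real_le_div_sq (θ : ℝ≥0) {u : ℝ} (hu : 0 < u) {A : Set ℕ}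
    (hA : ∀ k ∈ A, u ≤ |(k : ℝ) - θ|) : (poissonMeasure θ).real A ≤ θ / u ^ 2 := by
  obtain ⟨h, e⟩ := integral_poisson_centred_sq θ
  have h1 := mul_meas_ge_le_integral_of_nonneg (.of_forall fun k ↦ sq_nonneg _) h (u ^ 2)
  rw [e] at h1
  rw [le_div_iff₀ (by positivity), mul_comm]
  refine le_trans ?_ h1
  gcongr
  · simp
  · intro k hk
    rw [Set.mem_ofPred_eq, ← sq_abs ((k : ℝ) - θ)]
    exact pow_le_pow_left₀ hu.le (hA k hk) 2

theorem poisson_real_singleton_le {θ : ℝ≥0} (hθ : 0 < θ) {k : ℕ} (hk : (θ : ℝ) / 2 ≤ k) :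
    (poissonMeasure θ).real {k} ≤ 1 / √θ := by
  have hθ' : (0 : ℝ) < θ := hθ
  have hk0 : (0 : ℝ) < k := by linarith
  rw [poissonMeasure_real_singleton, div_le_div_iff₀ (by positivity) (by positivity), one_mul]
  refine le_trans ?_ (Stirling.le_factorial_stirling k)
  rw [mul_comm]
  have hs : √(θ : ℝ) ≤ √(2 * Real.pi * k) := by
    apply Real.sqrt_le_sqrt
    nlinarith [Real.pi_gt_three]
  have he : Real.exp (-θ) * (θ : ℝ) ^ k ≤ (k / Real.exp 1) ^ k := by
    have h1 : (θ : ℝ) / k ≤ Real.exp (θ / k - 1) := by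
      have := Real.add_one_le_exp ((θ : ℝ) / k - 1)
      linarith
    have h2 : (θ : ℝ) ^ k ≤ (k * Real.exp (θ / k - 1)) ^ k := by
      gcongr
      rwa [div_le_iff₀' hk0] at h1
    have h3 : Real.exp (θ / k - 1) ^ k = Real.exp θ / Real.exp 1 ^ k := by
      rw [Real.exp_sub, div_pow, ← Real.exp_nat_mul, mul_div_cancel₀ _ hk0.ne']
    calc Real.exp (-θ) * (θ : ℝ) ^ k ≤ Real.exp (-θ) * (k * Real.exp (θ / k - 1)) ^ k := by gcongr
      _ = (k / Real.exp 1) ^ k := by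
        rw [mul_pow, h3, Real.exp_neg, div_pow]
        field_simp
  exact mul_le_mul hs he (by positivity) (by positivity)

/-- The Poisson distribution puts little mass on short intervals. -/
theorem poisson_real_Ioo_le {θ : ℝ≥0} (hθ : 0 < θ) (z : ℝ) {w : ℝ} (hw : 0 ≤ w) :
    (poissonMeasure θ).real {k : ℕ | z < (k : ℝ) - θ ∧ (k : ℝ) - θ < z + w} ≤
      4 / θ + (w + 1) / √θ := by
  have hθ0 : (0 : ℝ) < θ := hθ
  set a := z + θ with ha
  set S : Finset ℕ := (Finset.Ioc ⌊a⌋₊ ⌊a + w⌋₊).filter fun k ↦ (θ : ℝ) / 2 ≤ k with hS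
  have hsub : {k : ℕ | z < (k : ℝ) - θ ∧ (k : ℝ) - θ < z + w} ⊆
      {k : ℕ | (θ : ℝ) / 2 ≤ |(k : ℝ) - θ|} ∪ S := by
    rintro k ⟨hk1, hk2⟩
    rcases le_or_gt ((θ : ℝ) / 2) k with hk | hk
    · right
      have hkpos : (0 : ℝ) < k := by linarith
      have hk0 : k ≠ 0 := by rintro rfl; simp at hkpos
      simp only [hS, Finset.coe_filter, Finset.mem_Ioc]
      exact ⟨⟨(Nat.floor_lt' hk0).2 (by linarith), Nat.le_floor (by linarith)⟩, hk⟩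
    · left
      rw [Set.mem_ofPred_eq, abs_of_neg (by linarith)]
      linarith
  have hcard : (S.card : ℝ) ≤ w + 1 := by
    refine le_trans (Nat.cast_le.2 (Finset.card_filter_le _ _)) ?_
    rw [Nat.card_Ioc]
    rcases le_total ⌊a + w⌋₊ ⌊a⌋₊ with h | h
    · rw [Nat.sub_eq_zero_of_le h]
      push_cast
      linarith
    · rw [Nat.cast_sub h]
      have h1 := Nat.lt_floor_add_one a
      rcases le_total 0 (a + w) with h2 | h2
      · have := Nat.floor_le h2
        linarith
      · rw [Nat.floor_of_nonpos h2]
        have : (0 : ℝ) ≤ ⌊a⌋₊ := Nat.cast_nonneg _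
        push_cast
        linarith
  have hmassS : (poissonMeasure θ).real (S : Set ℕ) ≤ (w + 1) / √θ := by
    rw [← sum_measureReal_singleton]
    calc ∑ k ∈ S, (poissonMeasure θ).real {k} ≤ ∑ k ∈ S, 1 / √(θ : ℝ) :=
          Finset.sum_le_sum fun k hk ↦ poisson_real_singleton_le hθ (Finset.mem_filter.1 hk).2
      _ = S.card * (1 / √(θ : ℝ)) := by rw [Finset.sum_const, nsmul_eq_mul]
      _ ≤ (w + 1) * (1 / √(θ : ℝ)) := by gcongr
      _ = _ := by ring
  have hcheb : (poissonMeasure θ).real {k : ℕ | (θ : ℝ) / 2 ≤ |(k : ℝ) - θ|} ≤ 4 / θ := by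
    refine (poisson_real_le_div_sq θ (by positivity) fun k hk ↦ hk).trans_eq ?_
    field_simp
    norm_num
  calc _ ≤ (poissonMeasure θ).real ({k : ℕ | (θ : ℝ) / 2 ≤ |(k : ℝ) - θ|} ∪ S) :=
        measureReal_mono hsub
    _ ≤ _ := (measureReal_union_le _ _).trans (add_le_add hcheb hmassS)

end Poisson

/-! ### Replacing indicators by Poisson variables -/

section Lindeberg

open MeasureTheory ProbabilityTheory
open scoped NNReal

/-- `f` is bounded by `1` and has, uniformly on the line, a second order Taylor expansion with
first and second derivatives `f₁` and `f₂`, the latter bounded by `B`, and a cubic remainder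
with constant `M`. -/
structure TaylorBound (f f₁ f₂ : ℝ → ℝ) (B M : ℝ) : Prop where
  abs_le_one : ∀ y, |f y| ≤ 1
  abs_second_le : ∀ y, |f₂ y| ≤ B
  remainder_le : ∀ y h, |f (y + h) - (f y + f₁ y * h + f₂ y / 2 * h ^ 2)| ≤ M * |h| ^ 3

/-- Taylor's formula on both sides of `y`, from a bound on the third derivative. -/
theorem abs_taylor_remainder_le {f f₁ f₂ f₃ : ℝ → ℝ} {M : ℝ} (h0 : ∀ y, HasDerivAt f (f₁ y) y)
    (h1 : ∀ y, HasDerivAt f₁ (f₂ y) y) (h2 : ∀ y, HasDerivAt f₂ (f₃ y) y) (h3 : ∀ y, |f₃ y| ≤ M)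
    (y h : ℝ) : |f (y + h) - (f y + f₁ y * h + f₂ y / 2 * h ^ 2)| ≤ M * |h| ^ 3 := by
  have hM : 0 ≤ M := (abs_nonneg _).trans (h3 0)
  -- A function vanishing at `0` is at most `h` times a bound on its derivative.
  have mvt : ∀ (F F' : ℝ → ℝ) (C r : ℝ), (∀ u, HasDerivAt F (F' u) u) → F 0 = 0 →
      (∀ u, |u| ≤ r → |F' u| ≤ C) → ∀ u, |u| ≤ r → |F u| ≤ C * |u| := by
    intro F F' C r hF hF0 hC u hu
    have hr : 0 ≤ r := (abs_nonneg u).trans hu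
    have := (convex_closedBall (0 : ℝ) r).norm_image_sub_le_of_norm_hasDerivWithin_le
      (f := F) (f' := F') (C := C) (x := 0) (y := u) (fun v _ ↦ (hF v).hasDerivWithinAt)
      (fun v hv ↦ hC v (by simpa using hv)) (by simpa using hr) (by simpa using hu)
    simpa [hF0] using this
  have d2 : ∀ u, HasDerivAt (fun u ↦ f₂ (y + u) - f₂ y) (f₃ (y + u)) u := fun u ↦
    ((h2 (y + u)).comp_const_add y u).sub_const _
  have d1 : ∀ u, HasDerivAt (fun u ↦ f₁ (y + u) - (f₁ y + f₂ y * u)) (f₂ (y + u) - f₂ y) u :=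
    fun u ↦ ((h1 (y + u)).comp_const_add y u).sub
      (by simpa using ((hasDerivAt_id u).const_mul (f₂ y)).const_add (f₁ y))
  have d0 : ∀ u, HasDerivAt (fun u ↦ f (y + u) - (f y + f₁ y * u + f₂ y / 2 * u ^ 2))
      (f₁ (y + u) - (f₁ y + f₂ y * u)) u := fun u ↦ by
    refine ((h0 (y + u)).comp_const_add y u).sub ?_
    have h := (((hasDerivAt_id u).const_mul (f₁ y)).const_add (f y)).add
      (((hasDerivAt_id u).pow 2).const_mul (f₂ y / 2))
    refine h.congr_deriv ?_
    simp
    ring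
  have b2 := mvt _ _ M |h| d2 (by simp) fun u _ ↦ h3 _
  have b1 := mvt _ _ (M * |h|) |h| d1 (by simp) fun u hu ↦
    (b2 u hu).trans (mul_le_mul_of_nonneg_left hu hM)
  have b0 := mvt _ _ (M * |h| * |h|) |h| d0 (by simp) fun u hu ↦
    (b1 u hu).trans (mul_le_mul_of_nonneg_left hu (by positivity))
  exact (b0 h le_rfl).trans_eq (by ring)

/-- A smooth step from `0` to `1` on the unit interval has bounded derivatives. -/
theorem exists_smooth_step : ∃ (f f₁ f₂ : ℝ → ℝ) (B M : ℝ), TaylorBound f f₁ f₂ B M ∧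
    (∀ y, 0 ≤ f y) ∧ (∀ y, f y ≤ 1) ∧ (∀ y ≤ 0, f y = 0) ∧ ∀ y, 1 ≤ y → f y = 1 := by
  have c0 : ContDiff ℝ 3 Real.smoothTransition := Real.smoothTransition.contDiff (n := 3)
  have c1 : ContDiff ℝ 2 (deriv Real.smoothTransition) := by
    have e : (2 + 1 : WithTop ℕ∞) = 3 := by norm_num
    exact (contDiff_succ_iff_deriv.1 (e ▸ c0)).2.2
  have c2 : ContDiff ℝ 1 (deriv (deriv Real.smoothTransition)) := by
    have e : (1 + 1 : WithTop ℕ∞) = 2 := by norm_num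
    exact (contDiff_succ_iff_deriv.1 (e ▸ c1)).2.2
  have c3 : Continuous (deriv (deriv (deriv Real.smoothTransition))) := c2.continuous_deriv le_rfl
  have s1 : HasCompactSupport (deriv Real.smoothTransition) := by
    refine HasCompactSupport.of_support_subset_isCompact (isCompact_Icc (a := (0 : ℝ)) (b := 1)) ?_
    intro y hy
    by_contra hy'
    refine hy ?_
    rcases lt_or_ge y 0 with h | h
    · have : Real.smoothTransition =ᶠ[nhds y] fun _ ↦ 0 := by
        filter_upwards [gt_mem_nhds h] with u hu using Real.smoothTransition.zero_of_nonpos hu.le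
      rw [this.deriv_eq, deriv_const]
    · have h1 : 1 < y := by
        by_contra h1
        exact hy' ⟨h, not_lt.1 h1⟩
      have : Real.smoothTransition =ᶠ[nhds y] fun _ ↦ 1 := by
        filter_upwards [lt_mem_nhds h1] with u hu using Real.smoothTransition.one_of_one_le hu.le
      rw [this.deriv_eq, deriv_const]
  obtain ⟨B, hB⟩ := s1.deriv.exists_bound_of_continuous (c2.continuous)
  obtain ⟨M, hM⟩ := s1.deriv.deriv.exists_bound_of_continuous c3
  refine ⟨Real.smoothTransition, deriv Real.smoothTransition,
    deriv (deriv Real.smoothTransition), B, M, ⟨fun y ↦ ?_, hB, fun y h ↦ ?_⟩,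
    Real.smoothTransition.nonneg, Real.smoothTransition.le_one,
    fun y ↦ Real.smoothTransition.zero_of_nonpos, fun y ↦ Real.smoothTransition.one_of_one_le⟩
  · rw [abs_of_nonneg (Real.smoothTransition.nonneg y)]
    exact Real.smoothTransition.le_one y
  · exact abs_taylor_remainder_le
      (fun y ↦ (c0.differentiable (by norm_num) y).hasDerivAt)
      (fun y ↦ (c1.differentiable (by norm_num) y).hasDerivAt)
      (fun y ↦ (c2.differentiable (by norm_num) y).hasDerivAt) hM y h

namespace TaylorBound

variable {f f₁ f₂ : ℝ → ℝ} {B M : ℝ}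

theorem second_nonneg (h : TaylorBound f f₁ f₂ B M) : 0 ≤ B :=
  (abs_nonneg _).trans (h.abs_second_le 0)

theorem remainder_nonneg (h : TaylorBound f f₁ f₂ B M) : 0 ≤ M := by
  simpa using (abs_nonneg _).trans (h.remainder_le 0 1)

theorem comp_affine (h : TaylorBound f f₁ f₂ B M) (z : ℝ) {w : ℝ} (hw : 0 < w) :
    TaylorBound (fun y ↦ f ((y - z) / w)) (fun y ↦ f₁ ((y - z) / w) / w)
      (fun y ↦ f₂ ((y - z) / w) / w ^ 2) (B / w ^ 2) (M / w ^ 3) where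
  abs_le_one y := h.abs_le_one _
  abs_second_le y := by
    rw [abs_div, abs_of_pos (pow_pos hw 2)]
    gcongr
    exact h.abs_second_le _
  remainder_le y u := by
    have := h.remainder_le ((y - z) / w) (u / w)
    rw [abs_div, abs_of_pos hw, div_pow] at this
    refine Eq.trans_le ?_ (this.trans_eq (by ring))
    congr 2
    · congr 1
      ring
    · ring

variable {G : Type*} [Fintype G] [Nonempty G] {I : G → ℝ} {p : ℝ}

/-- Exchanging one centred indicator of weight `a` for a centred Poisson variable of mean
`a ^ 2 * p`: the first moments agree, the second ones differ by `(a * p) ^ 2`. -/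
theorem abs_expect_sub_integral_poisson_le (h : TaylorBound f f₁ f₂ B M) (hI : IsIndicator I p)
    {a R : ℝ} (haR : |a| ≤ R) {θ : ℝ≥0} (hθ : (θ : ℝ) = a ^ 2 * p) (hθ1 : θ ≤ 1) (y : ℝ) :
    |(𝔼 g, f (y + a * (I g - p))) - ∫ k, f (y + ((k : ℝ) - θ)) ∂poissonMeasure θ| ≤
      B / 2 * p * θ + M * (R + 6) * θ := by
  have hp := hI.nonneg
  have hp1 := hI.le_one
  have hM := h.remainder_nonneg
  obtain ⟨i1, e1⟩ := integral_poisson_centred θ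
  obtain ⟨i2, e2⟩ := integral_poisson_centred_sq θ
  obtain ⟨i3, e3⟩ := integral_poisson_abs_cube_le θ hθ1
  have hind : |(𝔼 g, f (y + a * (I g - p))) - (f y + f₂ y / 2 * (a ^ 2 * p * (1 - p)))| ≤
      M * (R * θ) := by
    have hT : 𝔼 g, (f y + f₁ y * (a * (I g - p)) + f₂ y / 2 * (a * (I g - p)) ^ 2) =
        f y + f₂ y / 2 * (a ^ 2 * p * (1 - p)) := by
      simp only [Finset.expect_add_distrib, Fintype.expect_const, ← Finset.mul_expect,
        hI.expect_centred, hI.expect_centred_sq, mul_zero, add_zero]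
    rw [← hT, ← Finset.expect_sub_distrib]
    refine (Finset.abs_expect_le _ _).trans ?_
    have : ∀ g, |f (y + a * (I g - p)) -
        (f y + f₁ y * (a * (I g - p)) + f₂ y / 2 * (a * (I g - p)) ^ 2)| ≤
        M * (R * (a * (I g - p)) ^ 2) := fun g ↦ by
      refine (h.remainder_le y _).trans (mul_le_mul_of_nonneg_left ?_ hM)
      rw [pow_succ', sq_abs]
      refine mul_le_mul_of_nonneg_right ?_ (sq_nonneg _)
      rw [abs_mul]
      refine (mul_le_of_le_one_right (abs_nonneg a) ?_).trans haR
      rcases hI.zero_or_one g with h | h <;> rw [h, abs_le] <;> constructor <;> linarith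
    refine (expect_mono this).trans ?_
    rw [← Finset.mul_expect, ← Finset.mul_expect, hI.expect_centred_sq, hθ]
    have hR : 0 ≤ R := (abs_nonneg _).trans haR
    refine mul_le_mul_of_nonneg_left (mul_le_mul_of_nonneg_left ?_ hR) hM
    nlinarith [mul_nonneg (sq_nonneg a) (sq_nonneg p)]
  have hpoi : |(∫ k, f (y + ((k : ℝ) - θ)) ∂poissonMeasure θ) - (f y + f₂ y / 2 * θ)| ≤
      M * (6 * θ) := by
    have j1 : Integrable (fun k : ℕ ↦ f y + f₁ y * ((k : ℝ) - θ)) (poissonMeasure θ) :=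
      (integrable_const _).add (i1.const_mul _)
    have j2 : Integrable (fun k : ℕ ↦ f₂ y / 2 * ((k : ℝ) - θ) ^ 2) (poissonMeasure θ) :=
      i2.const_mul _
    have hT : ∫ k, (f y + f₁ y * ((k : ℝ) - θ) + f₂ y / 2 * ((k : ℝ) - θ) ^ 2) ∂poissonMeasure θ =
        f y + f₂ y / 2 * θ := by
      rw [integral_add j1 j2, integral_add (integrable_const _) (i1.const_mul _),
        integral_const_mul, integral_const_mul, e1, e2]
      simp
    have j3 : Integrable (fun k : ℕ ↦ f y + f₁ y * ((k : ℝ) - θ) + f₂ y / 2 * ((k : ℝ) - θ) ^ 2)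
        (poissonMeasure θ) := j1.add j2
    rw [← hT, ← integral_sub (integrable_poisson_of_bound _ fun k ↦ h.abs_le_one _) j3]
    refine (abs_integral_le_integral_abs).trans ?_
    refine (integral_mono_of_nonneg (.of_forall fun k ↦ abs_nonneg _) (i3.const_mul M)
      (.of_forall fun k ↦ h.remainder_le y _)).trans ?_
    rw [integral_const_mul]
    exact mul_le_mul_of_nonneg_left e3 hM
  have hdiff : |(f y + f₂ y / 2 * (a ^ 2 * p * (1 - p))) - (f y + f₂ y / 2 * θ)| ≤
      B / 2 * p * θ := by
    rw [hθ, show (f y + f₂ y / 2 * (a ^ 2 * p * (1 - p))) - (f y + f₂ y / 2 * (a ^ 2 * p)) =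
      -(f₂ y / 2 * p * (a ^ 2 * p)) by ring, abs_neg, abs_mul, abs_mul, abs_div,
      abs_of_nonneg hp, abs_of_nonneg (mul_nonneg (sq_nonneg a) hp), abs_two]
    gcongr
    exact h.abs_second_le y
  rw [abs_sub_comm] at hpoi
  have t1 := abs_sub_le (𝔼 g, f (y + a * (I g - p)))
    (f y + f₂ y / 2 * (a ^ 2 * p * (1 - p))) (∫ k, f (y + ((k : ℝ) - θ)) ∂poissonMeasure θ)
  have t2 := abs_sub_le (f y + f₂ y / 2 * (a ^ 2 * p * (1 - p))) (f y + f₂ y / 2 * θ)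
    (∫ k, f (y + ((k : ℝ) - θ)) ∂poissonMeasure θ)
  linarith

/-- Lindeberg's exchange argument: a weighted sum of independent centred indicators against a
centred Poisson variable with (almost) the same variance. -/
theorem abs_expect_sum_sub_integral_poisson_le (h : TaylorBound f f₁ f₂ B M)
    (hI : IsIndicator I p) {R : ℝ} {n : ℕ} {a : Fin n → ℝ} (haR : ∀ i, |a i| ≤ R)
    {θ : Fin n → ℝ≥0} (hθ : ∀ i, (θ i : ℝ) = a i ^ 2 * p) (hθ1 : ∀ i, θ i ≤ 1) (y : ℝ) :
    |(𝔼 H : Fin n → G, f (y + ∑ i, a i * (I (H i) - p))) -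
        ∫ k, f (y + ((k : ℝ) - (∑ i, θ i : ℝ≥0))) ∂poissonMeasure (∑ i, θ i)| ≤
      (B / 2 * p + M * (R + 6)) * ∑ i, (θ i : ℝ) := by
  induction n generalizing y with
  | zero =>
    have h0 : ∫ k, f (y + (k : ℝ)) ∂poissonMeasure 0 = f y := by
      have : ∀ k : ℕ, Real.exp (-0) * (0 : ℝ) ^ k / k.factorial * f (y + k) =
          if k = 0 then f y else 0 := fun k ↦ by
        rcases eq_or_ne k 0 with rfl | hk <;> simp [*]
      rw [integral_poissonMeasure]
      simp only [smul_eq_mul, NNReal.coe_zero, this]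
      exact tsum_ite_eq 0 _
    simp [h0]
  | succ n ih =>
    set Θ : ℝ≥0 := ∑ i : Fin n, θ i.succ with hΘ
    have hsum : ∑ i, θ i = θ 0 + Θ := Fin.sum_univ_succ _
    -- Exchange the remaining variables first, for every value of the first indicator.
    have s1 : |(𝔼 H : Fin (n + 1) → G, f (y + ∑ i, a i * (I (H i) - p))) -
        𝔼 g, ∫ k, f (y + a 0 * (I g - p) + ((k : ℝ) - Θ)) ∂poissonMeasure Θ| ≤
        (B / 2 * p + M * (R + 6)) * ∑ i : Fin n, (θ i.succ : ℝ) := by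
      rw [expect_fin_cons, ← Finset.expect_sub_distrib]
      refine (Finset.abs_expect_le _ _).trans ?_
      rw [← Fintype.expect_const (ι := G) ((B / 2 * p + M * (R + 6)) * _)]
      refine expect_mono fun g ↦ ?_
      simp only [Fin.sum_univ_succ, Fin.cons_zero, Fin.cons_succ, ← add_assoc]
      exact ih (fun i ↦ haR i.succ) (fun i ↦ hθ i.succ) (fun i ↦ hθ1 i.succ) _
    have hpoi : ∫ k, f (y + ((k : ℝ) - (∑ i, θ i : ℝ≥0))) ∂poissonMeasure (∑ i, θ i) =
        ∫ k, ∫ l, f (y + ((k : ℝ) - Θ) + ((l : ℝ) - θ 0)) ∂poissonMeasure (θ 0)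
          ∂poissonMeasure Θ := by
      rw [hsum, add_comm, integral_poisson_add Θ (θ 0) fun k ↦ h.abs_le_one _]
      refine integral_congr_ae (.of_forall fun k ↦ integral_congr_ae (.of_forall fun l ↦ ?_))
      simp only
      congr 1
      push_cast
      ring
    have hexp : 𝔼 g, ∫ k, f (y + a 0 * (I g - p) + ((k : ℝ) - Θ)) ∂poissonMeasure Θ =
        ∫ k, 𝔼 g, f (y + ((k : ℝ) - Θ) + a 0 * (I g - p)) ∂poissonMeasure Θ := by
      simp only [Fintype.expect_eq_sum_div_card]
      rw [integral_div, integral_finsetSum]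
      · simp only [add_right_comm]
      · exact fun g _ ↦ integrable_poisson_of_bound _ fun k ↦ h.abs_le_one _
    have s2 : |(𝔼 g, ∫ k, f (y + a 0 * (I g - p) + ((k : ℝ) - Θ)) ∂poissonMeasure Θ) -
        ∫ k, f (y + ((k : ℝ) - (∑ i, θ i : ℝ≥0))) ∂poissonMeasure (∑ i, θ i)| ≤
        (B / 2 * p + M * (R + 6)) * θ 0 := by
      rw [hpoi, hexp, ← integral_sub]
      · refine abs_integral_le_integral_abs.trans ?_
        refine (integral_mono_of_nonneg (.of_forall fun k ↦ abs_nonneg _)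
          (integrable_const ((B / 2 * p + M * (R + 6)) * θ 0)) (.of_forall fun k ↦ ?_)).trans ?_
        · exact (h.abs_expect_sub_integral_poisson_le hI (haR 0) (hθ 0) (hθ1 0) _).trans_eq
            (by ring)
        · simp
      · refine integrable_poisson_of_bound (B := 1) _ fun k ↦ ?_
        refine (Finset.abs_expect_le _ _).trans ?_
        exact (expect_mono fun g ↦ h.abs_le_one _).trans_eq (Fintype.expect_one (ι := G))
      · refine integrable_poisson_of_bound (B := 1) _ fun k ↦ ?_
        refine abs_integral_le_integral_abs.trans ?_
        refine (integral_mono_of_nonneg (.of_forall fun k ↦ abs_nonneg _) (integrable_const 1)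
          (.of_forall fun k ↦ h.abs_le_one _)).trans ?_
        simp
    refine (abs_sub_le _ _ _).trans ((add_le_add s1 s2).trans_eq ?_)
    rw [Fin.sum_univ_succ]
    ring

end TaylorBound

/-- The upper tail of a weighted sum of independent centred indicators is at least that of the
centred Poisson variable with the same mean of squares, up to an error that vanishes when `p`
is small and the mean `Θ` is large (first choose `η` small). -/
theorem exists_poisson_tail_le : ∃ L : ℝ, 0 ≤ L ∧ ∀ {G : Type*} [Fintype G] [Nonempty G]
    {I : G → ℝ} {p : ℝ} (_ : IsIndicator I p) {n : ℕ} {a : Fin n → ℝ} (_ : ∀ i, |a i| ≤ 4)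
    {Θ : ℝ≥0} (_ : 0 < Θ) (_ : (Θ : ℝ) = p * ∑ i, a i ^ 2) (_ : 16 * p ≤ 1)
    (z : ℝ) {η : ℝ} (_ : 0 < η),
    (poissonMeasure Θ).real {k : ℕ | z < (k : ℝ) - Θ} ≤
      prob (fun H : Fin n → G ↦ z < ∑ i, a i * (I (H i) - p)) +
        L * (p / η ^ 2 + 1 / (η ^ 3 * √Θ)) + (4 / Θ + (η * √Θ + 1) / √Θ) := by
  obtain ⟨f, f₁, f₂, B, M, hf, hf0, hf1, hfz, hfo⟩ := exists_smooth_step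
  have hB := hf.second_nonneg
  have hM := hf.remainder_nonneg
  refine ⟨B / 2 + 10 * M, by positivity, ?_⟩
  intro G _ _ I p hI n a ha Θ hΘ hΘa hp16 z η hη
  have hΘ0 : (0 : ℝ) < Θ := hΘ
  have hp := hI.nonneg
  have hs : 0 < √(Θ : ℝ) := Real.sqrt_pos.2 hΘ0
  set w := η * √(Θ : ℝ) with hw
  have hw0 : 0 < w := by positivity
  set θ : Fin n → ℝ≥0 := fun i ↦ ⟨a i ^ 2 * p, by positivity⟩ with hθ
  have hθΘ : ∑ i, θ i = Θ := by
    ext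
    push_cast
    rw [hΘa, Finset.mul_sum]
    exact Finset.sum_congr rfl fun i _ ↦ mul_comm _ _
  have hθ1 : ∀ i, θ i ≤ 1 := fun i ↦ by
    rw [← NNReal.coe_le_coe]
    have h16 : a i ^ 2 ≤ 16 := by
      rw [← sq_abs]
      nlinarith [ha i, abs_nonneg (a i)]
    change a i ^ 2 * p ≤ 1
    nlinarith
  have key := (hf.comp_affine z hw0).abs_expect_sum_sub_integral_poisson_le hI ha
    (fun i ↦ rfl) hθ1 0
  have hsumθ : ∑ i, (θ i : ℝ) = Θ := by rw [← hθΘ]; push_cast; rfl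
  rw [hsumθ, hθΘ] at key
  simp only [zero_add] at key
  have herr : (B / w ^ 2 / 2 * p + M / w ^ 3 * (4 + 6)) * Θ ≤
      (B / 2 + 10 * M) * (p / η ^ 2 + 1 / (η ^ 3 * √(Θ : ℝ))) := by
    have hsq : √(Θ : ℝ) ^ 2 = Θ := Real.sq_sqrt hΘ0.le
    have : (B / w ^ 2 / 2 * p + M / w ^ 3 * (4 + 6)) * Θ =
        B / 2 * (p / η ^ 2) + 10 * M * (1 / (η ^ 3 * √(Θ : ℝ))) := by
      rw [hw, ← hsq]
      field_simp
      norm_num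
    rw [this]
    have e1 : 0 ≤ p / η ^ 2 := by positivity
    have e2 : 0 ≤ 1 / (η ^ 3 * √(Θ : ℝ)) := by positivity
    nlinarith [mul_nonneg hB e2, mul_nonneg hM e1]
  have hprob : 𝔼 H : Fin n → G, f ((∑ i, a i * (I (H i) - p) - z) / w) ≤
      prob (fun H : Fin n → G ↦ z < ∑ i, a i * (I (H i) - p)) :=
    expect_le_prob (fun H ↦ hf1 _) fun H hH ↦
      (hfz _ (div_nonpos_of_nonpos_of_nonneg (by linarith) hw0.le)).le
  have hmass : (poissonMeasure Θ).real {k : ℕ | z + w ≤ (k : ℝ) - Θ} ≤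
      ∫ k, f (((k : ℝ) - Θ - z) / w) ∂poissonMeasure Θ := by
    rw [← integral_indicator_one (MeasurableSet.of_discrete)]
    refine integral_mono (integrable_poisson_of_bound (B := 1) _ fun k ↦ ?_)
      (integrable_poisson_of_bound _ fun k ↦ hf.abs_le_one _) fun k ↦ ?_
    · rw [Set.indicator_apply]
      split_ifs <;> simp
    · refine Set.indicator_apply_le' (fun hk ↦ ?_) fun _ ↦ hf0 _
      rw [hfo _ ((one_le_div hw0).2 (by linarith [hk.out]))]
      simp
  have hsplit : (poissonMeasure Θ).real {k : ℕ | z < (k : ℝ) - Θ} ≤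
      (poissonMeasure Θ).real {k : ℕ | z + w ≤ (k : ℝ) - Θ} +
      (poissonMeasure Θ).real {k : ℕ | z < (k : ℝ) - Θ ∧ (k : ℝ) - Θ < z + w} := by
    refine (measureReal_mono fun k hk ↦ ?_).trans (measureReal_union_le _ _)
    rcases le_or_gt (z + w) ((k : ℝ) - Θ) with h | h
    exacts [Or.inl h, Or.inr ⟨hk, h⟩]
  have hanti := poisson_real_Ioo_le hΘ z hw0.le
  have := (abs_le.1 key).1
  linarith

end Lindeberg

/-! ### The first period -/

section FirstLevel

open MeasureTheory ProbabilityTheory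
open scoped NNReal

/-- The attack flow wins the first period unless its counter receives little or another counter
receives much legitimate traffic, relative to the common mean. -/
theorem prob_lt_le_prob_win_add {G : Type*} [Fintype G] [Nonempty G] {m n : ℕ} {p : ℝ}
    {J : Fin m → G → ℝ} (hJ : ∀ j, IsIndicator (J j) p) (a : Fin m) {x : Fin n → ℝ}
    (hx : ∀ i, 0 ≤ x i) (hx1 : ∀ i, x i ≤ 1) {α z U s : ℝ} (hz : U - α ≤ z) (hs : 0 ≤ s)
    (hs1 : s ≤ 1) :
    prob (fun H : Fin n → G ↦ z < ∑ i, x i * (J a (H i) - p)) ≤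
      prob (fun H : Fin n → G ↦ ∀ j ≠ a, ∑ i, x i * J j (H i) < α + ∑ i, x i * J a (H i)) +
      m * Real.exp (-(s * U) + (p * ∑ i, x i ^ 2) * (s ^ 2 * (1 / 2 + s / 4))) := by
  calc _ ≤ prob (fun H : Fin n → G ↦
          (∀ j ≠ a, ∑ i, x i * J j (H i) < α + ∑ i, x i * J a (H i)) ∨
          ∃ j ∈ Finset.univ, U < ∑ i, x i * (J j (H i) - p)) := by
        refine prob_mono fun H hH ↦ ?_
        by_contra! hcon
        obtain ⟨⟨j, -, hj⟩, hU⟩ := hcon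
        have h := hU j (Finset.mem_univ j)
        simp only [mul_sub, Finset.sum_sub_distrib] at h hH
        linarith
    _ ≤ _ := by
        refine (prob_or_le _ _).trans (add_le_add_right ((prob_exists_le _ _).trans ?_) _)
        refine (Finset.sum_le_sum fun j _ ↦ (hJ j).prob_lt_sum_le hx hx1 hs hs1 U).trans_eq ?_
        simp

/-- The case of legitimate traffic of small variance: the attack flow wins with high
probability. -/
theorem one_le_prob_win_add {G : Type*} [Fintype G] [Nonempty G] {m n : ℕ} (hm : 0 < m)
    {J : Fin m → G → ℝ} (hJ : ∀ j, IsIndicator (J j) (1 / m)) (a : Fin m) {x : Fin n → ℝ}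
    (hx : ∀ i, 0 ≤ x i) (hx1 : ∀ i, x i ≤ 1) {N α : ℝ} (hN : 0 < N) (hl : 1 ≤ Real.log N)
    (hlam : 32 * Real.log N ≤ N / m)
    (hv : (1 / m : ℝ) * ∑ i, x i ^ 2 ≤ N / m / 16)
    (hα : 3 / 4 * √(2 * (N / m) * Real.log N) ≤ α) :
    1 ≤ prob (fun H : Fin n → G ↦ ∀ j ≠ a, ∑ i, x i * J j (H i) < α + ∑ i, x i * J a (H i)) +
      (1 / (2 * Real.log N) + 1 / (N / m)) := by
  have hm0 : (0 : ℝ) < m := Nat.cast_pos.2 hm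
  set l := Real.log N with hl_def
  set lam := N / m with hlam_def
  have hlam0 : 0 < lam := by positivity
  have hl0 : 0 < l := by linarith
  set t := √(2 * lam * l) with ht
  have ht2 : t ^ 2 = 2 * lam * l := Real.sq_sqrt (by positivity)
  have ht0 : 0 < t := Real.sqrt_pos.2 (by positivity)
  set v := (1 / m : ℝ) * ∑ i, x i ^ 2 with hv_def
  -- The Bernstein parameter `4 * √(2 * l / lam)`, for which `s * t = 8 * l`.
  set s := 4 * (t / lam) with hs_def
  have hs0 : 0 ≤ s := by positivity
  have hs2 : s ^ 2 = 32 * l / lam := by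
    rw [hs_def, mul_pow, div_pow, ht2]
    field_simp
    norm_num
  have hs1 : s ≤ 1 := by
    have : s ^ 2 ≤ 1 := by rw [hs2, div_le_one hlam0]; exact hlam
    nlinarith
  have hst : s * (t / 2) = 4 * l := by
    have : s * (t / 2) = 2 * t ^ 2 / lam := by rw [hs_def]; field_simp; norm_num
    rw [this, ht2]
    field_simp
    norm_num
  have hexp : -(s * (t / 2)) + v * (s ^ 2 * (1 / 2 + s / 4)) ≤ -l := by
    have h1 : v * (s ^ 2 * (1 / 2 + s / 4)) ≤ lam / 16 * (s ^ 2 * (3 / 4)) := by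
      gcongr
      linarith
    have h2 : lam / 16 * (s ^ 2 * (3 / 4)) = 3 / 2 * l := by
      rw [hs2]
      field_simp
      norm_num
    linarith
  have hmexp : (m : ℝ) * Real.exp (-(s * (t / 2)) + v * (s ^ 2 * (1 / 2 + s / 4))) ≤
      1 / lam := by
    calc _ ≤ (m : ℝ) * Real.exp (-l) := by gcongr
      _ = 1 / lam := by rw [Real.exp_neg, hl_def, Real.exp_log hN, hlam_def]; field_simp
  have hwin := prob_lt_le_prob_win_add hJ a hx hx1 (α := α) (z := -(t / 4)) (U := t / 2)
    (by linarith) hs0 hs1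
  have hcheb : prob (fun H : Fin n → G ↦ ¬ -(t / 4) < ∑ i, x i * (J a (H i) - 1 / m)) ≤
      1 / (2 * l) := by
    have hsq := (hJ a).expect_sum_sq_le x
    refine (prob_le_expect_sq_div (u := t / 4) (by positivity) fun H hH ↦ ?_).trans
      ((div_le_div_of_nonneg_right (hsq.trans hv) (sq_nonneg _)).trans_eq ?_)
    · rw [not_lt] at hH
      exact le_abs.2 (Or.inr (by linarith))
    · rw [div_pow, ht2]
      field_simp
      norm_num
  rw [prob_not] at hcheb
  linarith

/-- The exponent in Bernstein's inequality at the deviation `c * √(2 * l * v)`, for the parameter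
`c * √(2 * l / v)`, exceeds the Gaussian exponent `-c ^ 2 * l` by a third order term of at most
`3 * c ^ 3 * l * √(l / lam)`. With `l = log N`, the bound `3 - l` makes the union bound over `m`
counters of order `m / N`. -/
theorem bernstein_exponent_le {c l lam v : ℝ} (hl0 : 0 < l) (hv0 : 0 < v) (hc : 1 ≤ c)
    (hv : lam / 16 < v) (hlam0 : 0 < lam) (hlc : 32 * c ^ 2 * l ≤ lam)
    (hB : 3 * c ^ 3 * l * √(l / lam) ≤ (c ^ 2 - 1) * l + 3) :
    c * √(2 * l / v) ≤ 1 ∧ -(c * √(2 * l / v) * (c * √(2 * l * v))) +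
      v * ((c * √(2 * l / v)) ^ 2 * (1 / 2 + c * √(2 * l / v) / 4)) ≤ 3 - l := by
  set s := c * √(2 * l / v) with hs_def
  have hs0 : 0 ≤ s := by positivity
  have hs2 : s ^ 2 = c ^ 2 * (2 * l / v) := by
    rw [hs_def, mul_pow, Real.sq_sqrt (by positivity)]
  have hs1 : s ≤ 1 := by
    have : s ^ 2 ≤ 1 := by
      rw [hs2, mul_div_assoc', div_le_one hv0]
      nlinarith
    nlinarith
  have hsU : s * (c * √(2 * l * v)) = 2 * c ^ 2 * l := by
    have h2 : √(2 * l / v) * √(2 * l * v) = 2 * l := by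
      rw [← Real.sqrt_mul (by positivity), show 2 * l / v * (2 * l * v) = (2 * l) ^ 2 by
        field_simp, Real.sqrt_sq (by positivity)]
    rw [hs_def]
    linear_combination c ^ 2 * h2
  have hsq : s ≤ 6 * (c * √(l / lam)) := by
    rw [← Real.sqrt_sq hs0, hs2, show 6 * (c * √(l / lam)) = √((6 * c) ^ 2) * √(l / lam) by
      rw [Real.sqrt_sq (by positivity)]; ring, ← Real.sqrt_mul (by positivity)]
    apply Real.sqrt_le_sqrt
    rw [mul_pow, mul_assoc, mul_left_comm]
    refine mul_le_mul_of_nonneg_left ?_ (sq_nonneg c)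
    rw [mul_div_assoc', div_le_div_iff₀ hv0 hlam0]
    nlinarith
  have h1 : v * (s ^ 2 * (1 / 2 + s / 4)) = c ^ 2 * l + c ^ 2 * l / 2 * s := by
    rw [hs2]
    field_simp
    ring
  have h2 : c ^ 2 * l / 2 * s ≤ c ^ 2 * l / 2 * (6 * (c * √(l / lam))) := by gcongr
  have h3 : c ^ 2 * l / 2 * (6 * (c * √(l / lam))) = 3 * c ^ 3 * l * √(l / lam) := by ring
  exact ⟨hs1, by linarith⟩

/-- The case of legitimate traffic of large variance: rescaled to variance `N / m`, the traffic in
the counter of the attack flow is compared with the Poisson distribution of mean `N / m`, while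
Bernstein's inequality bounds the other counters. -/
theorem exists_poisson_tail_le_prob_win_add : ∃ L : ℝ, 0 ≤ L ∧
    ∀ {G : Type*} [Fintype G] [Nonempty G] {m n : ℕ} {J : Fin m → G → ℝ}
    (_ : ∀ j, IsIndicator (J j) (1 / m)) (a : Fin m) {x : Fin n → ℝ} (_ : ∀ i, 0 ≤ x i)
    (_ : ∀ i, x i ≤ 1) {N α c η : ℝ} (_ : ∑ i, x i ≤ N) (_ : 0 < N) (_ : 1 ≤ c) (_ : 0 < η)
    (_ : (16 : ℝ) ≤ m) (_ : 0 < Real.log N) (_ : 32 * c ^ 2 * Real.log N ≤ N / m)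
    (_ : 3 * c ^ 3 * Real.log N * √(Real.log N / (N / m)) ≤ (c ^ 2 - 1) * Real.log N + 3)
    (_ : N / m / 16 < (1 / m : ℝ) * ∑ i, x i ^ 2) (_ : 0 ≤ α),
    (poissonMeasure (N / m).toNNReal).real
        {k : ℕ | c * √(2 * (N / m) * Real.log N) - α < (k : ℝ) - (N / m).toNNReal} ≤
      prob (fun H : Fin n → G ↦ ∀ j ≠ a, ∑ i, x i * J j (H i) < α + ∑ i, x i * J a (H i)) +
        (L * (1 / m / η ^ 2 + 1 / (η ^ 3 * √(N / m))) +
          (4 / (N / m) + (η * √(N / m) + 1) / √(N / m)) + Real.exp 3 / (N / m)) := by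
  obtain ⟨L, hL, htail⟩ := exists_poisson_tail_le
  refine ⟨L, hL, ?_⟩
  intro G _ _ m n J hJ a x hx hx1 N α c η hxN hN hc hη0 hm16 hl0 hlc hB hv hα0
  have hm0 : (0 : ℝ) < m := by linarith
  set l := Real.log N with hl_def
  set lam := N / m with hlam_def
  set t := √(2 * lam * l) with ht
  set v := (1 / m : ℝ) * ∑ i, x i ^ 2 with hv_def
  have hlam0 : 0 < lam := by positivity
  have hv_le : v ≤ lam := by
    rw [hv_def, hlam_def, div_mul_eq_mul_div, one_mul]
    gcongr
    refine (Finset.sum_le_sum fun i _ ↦ ?_).trans hxN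
    nlinarith [hx i, hx1 i]
  have hv0 : 0 < v := by linarith
  -- The factor that rescales the traffic from variance `v` to variance `lam`.
  set σ := √(lam / v) with hσ
  have hσ2 : σ ^ 2 = lam / v := Real.sq_sqrt (by positivity)
  have hσ1 : 1 ≤ σ := Real.one_le_sqrt.2 ((one_le_div hv0).2 hv_le)
  have hσ4 : σ ≤ 4 := by
    rw [hσ, Real.sqrt_le_left (by norm_num), div_le_iff₀ hv0]
    linarith
  have hlamc : ((lam.toNNReal : ℝ≥0) : ℝ) = lam := Real.coe_toNNReal _ hlam0.le
  have htl := htail (hJ a) (a := fun i ↦ σ * x i) (fun i ↦ by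
      rw [abs_of_nonneg (mul_nonneg (by linarith) (hx i))]
      nlinarith [hx i, hx1 i]) (Θ := lam.toNNReal) (Real.toNNReal_pos.2 hlam0)
    (by
      simp only [mul_pow]
      rw [hlamc, ← Finset.mul_sum, mul_left_comm, ← hv_def, hσ2]
      field_simp)
    (by rw [mul_one_div, div_le_one hm0]; exact hm16) (c * t - α) hη0
  rw [hlamc] at htl ⊢
  set U := c * √(2 * l * v) with hU
  have hσU : σ * U = c * t := by
    rw [hU, hσ, ht, mul_left_comm, ← Real.sqrt_mul (by positivity)]
    congr 2
    field_simp
  obtain ⟨hs1, hexp⟩ := bernstein_exponent_le hl0 hv0 hc hv hlam0 hlc hB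
  set s := c * √(2 * l / v) with hs_def
  have hs0 : 0 ≤ s := by positivity
  have hmexp : (m : ℝ) * Real.exp (-(s * U) + v * (s ^ 2 * (1 / 2 + s / 4))) ≤
      Real.exp 3 / lam := by
    calc _ ≤ (m : ℝ) * Real.exp (3 - l) := by gcongr
      _ = Real.exp 3 / lam := by
        rw [Real.exp_sub, hl_def, Real.exp_log hN, hlam_def]
        field_simp
  have hwin := prob_lt_le_prob_win_add hJ a hx hx1 (α := α) (z := U - α) le_rfl hs0 hs1
  have hscale : prob (fun H : Fin n → G ↦ c * t - α < ∑ i, σ * x i * (J a (H i) - 1 / m)) ≤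
      prob (fun H : Fin n → G ↦ U - α < ∑ i, x i * (J a (H i) - 1 / m)) := by
    refine prob_mono fun H hH ↦ ?_
    simp only [mul_assoc, ← Finset.mul_sum] at hH
    have hσ0 : 0 < σ := by linarith
    have h1 : σ * (U - α) ≤ c * t - α := by
      nlinarith [mul_nonneg (sub_nonneg.2 hσ1) hα0]
    exact lt_of_mul_lt_mul_left (h1.trans_lt hH) hσ0.le
  linarith

/-- The attack flow wins the first period with at least the Poisson tail probability of the
detection bound, asymptotically in the number `m` of counters and the load `N / m`. -/
theorem exists_poisson_tail_le_prob_win {ε : ℝ} (hε : 0 < ε) : ∃ C : ℝ,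
    ∀ {G : Type*} [Fintype G] [Nonempty G] {m n : ℕ} {J : Fin m → G → ℝ}
    (_ : ∀ j, IsIndicator (J j) (1 / m)) (a : Fin m) {x : Fin n → ℝ} (_ : ∀ i, 0 ≤ x i)
    (_ : ∀ i, x i ≤ 1) {N α c : ℝ} (_ : ∑ i, x i ≤ N) (_ : 1 ≤ c) (_ : C ≤ m)
    (_ : C ≤ N / m) (_ : C ≤ Real.log N) (_ : 32 * c ^ 2 * Real.log N ≤ N / m)
    (_ : 3 * c ^ 3 * Real.log N * √(Real.log N / (N / m)) ≤ (c ^ 2 - 1) * Real.log N + 3)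
    (_ : 3 / 4 * √(2 * (N / m) * Real.log N) ≤ α),
    (poissonMeasure (N / m).toNNReal).real
        {k : ℕ | c * √(2 * (N / m) * Real.log N) - α < (k : ℝ) - (N / m).toNNReal} ≤
      prob (fun H : Fin n → G ↦ ∀ j ≠ a, ∑ i, x i * J j (H i) < α + ∑ i, x i * J a (H i)) +
        ε := by
  obtain ⟨L, hL, hlarge⟩ := exists_poisson_tail_le_prob_win_add
  set η := ε / 2 with hη
  have hη0 : 0 < η := by positivity
  set D := L / η ^ 2 + L / η ^ 3 + 1 + 4 + Real.exp 3 with hD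
  have hD0 : 0 < D := by positivity
  -- Every error term but `η` is at most its share of `D` divided by `√C`.
  refine ⟨max 16 ((D / η) ^ 2), ?_⟩
  intro G _ _ m n J hJ a x hx hx1 N α c hxN hc hCm hClam hCl hlc hB hα
  have hm16 : (16 : ℝ) ≤ m := (le_max_left _ _).trans hCm
  have hm0 : (0 : ℝ) < m := by linarith
  have hlam16 : 16 ≤ N / m := (le_max_left _ _).trans hClam
  have hl16 : 16 ≤ Real.log N := (le_max_left _ _).trans hCl
  have hN : 0 < N := by
    by_contra! h
    have := div_nonpos_of_nonpos_of_nonneg h hm0.le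
    linarith
  have root : ∀ y : ℝ, max 16 ((D / η) ^ 2) ≤ y → 1 ≤ √y ∧ √y ≤ y ∧ D / √y ≤ η := by
    intro y hy
    have hy16 : 16 ≤ y := (le_max_left _ _).trans hy
    have h1 : 1 ≤ √y := Real.one_le_sqrt.2 (by linarith)
    refine ⟨h1, ?_, ?_⟩
    · nlinarith [Real.mul_self_sqrt (show 0 ≤ y by linarith)]
    · rw [div_le_iff₀ (by linarith), ← div_le_iff₀' hη0]
      exact Real.le_sqrt_of_sq_le ((le_max_right _ _).trans hy)
  set l := Real.log N with hl_def
  set lam := N / m with hlam_def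
  set v := (1 / m : ℝ) * ∑ i, x i ^ 2 with hv_def
  have hlam0 : 0 < lam := by linarith
  have hl0 : 0 < l := by linarith
  obtain ⟨r1, r2, r3⟩ := root lam hClam
  rcases le_or_gt v (lam / 16) with hv | hv
  · -- Small variance.
    have h32 : 32 * l ≤ lam := by
      refine le_trans ?_ hlc
      nlinarith [mul_nonneg hl0.le (show 0 ≤ c ^ 2 - 1 by nlinarith)]
    have h := one_le_prob_win_add (by exact_mod_cast hm0) hJ a hx hx1 hN (by linarith) h32 hv hα
    obtain ⟨q1, q2, q3⟩ := root l hCl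
    have e1 : 1 / (2 * l) ≤ η := by
      refine le_trans ?_ q3
      gcongr
      · have : 0 ≤ L / η ^ 2 + L / η ^ 3 := by positivity
        linarith [Real.exp_pos 3]
      · linarith
    have e2 : 1 / lam ≤ η := by
      refine le_trans ?_ r3
      gcongr
      have : 0 ≤ L / η ^ 2 + L / η ^ 3 := by positivity
      linarith [Real.exp_pos 3]
    refine measureReal_le_one.trans (h.trans (add_le_add_right ?_ _))
    rw [← hl_def, ← hlam_def]
    linarith
  · have hα0 : 0 ≤ α := le_trans (by positivity) hα
    refine (hlarge hJ a hx hx1 hxN hN hc hη0 hm16 hl0 hlc hB hv hα0).trans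
      (add_le_add_right ?_ _)
    obtain ⟨q1, q2, q3⟩ := root m hCm
    set ρ := min √(m : ℝ) √lam with hρ
    have hρ1 : 1 ≤ ρ := le_min q1 r1
    have hρD : D / ρ ≤ η := by
      rcases min_choice √(m : ℝ) √lam with h | h <;> rw [hρ, h] <;> assumption
    have e1 : L * (1 / m / η ^ 2) ≤ L / η ^ 2 / ρ := by
      rw [show L * (1 / m / η ^ 2) = L / η ^ 2 / m by field_simp]
      gcongr
      exact (min_le_left _ _).trans q2
    have e2 : L * (1 / (η ^ 3 * √lam)) ≤ L / η ^ 3 / ρ := by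
      rw [show L * (1 / (η ^ 3 * √lam)) = L / η ^ 3 / √lam by field_simp]
      gcongr
      exact min_le_right _ _
    have e3 : 4 / lam ≤ 4 / ρ := by
      gcongr
      exact (min_le_right _ _).trans r2
    have e4 : (η * √lam + 1) / √lam ≤ η + 1 / ρ := by
      rw [add_div, mul_div_cancel_right₀ _ (by positivity)]
      gcongr
      exact min_le_right _ _
    have e5 : Real.exp 3 / lam ≤ Real.exp 3 / ρ := by
      gcongr
      exact (min_le_right _ _).trans r2
    have e6 : D / ρ = L / η ^ 2 / ρ + L / η ^ 3 / ρ + 1 / ρ + 4 / ρ + Real.exp 3 / ρ := by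
      rw [hD]
      ring
    rw [mul_add, ← hlam_def]
    linarith

/-- If the attack flow sends less than three quarters of the deviation `t` of the largest
counter, the detection bound is itself negligible. -/
theorem poisson_tail_le_of_lt {N α c : ℝ} {m : ℕ} (hlam : 0 < N / m) (hl : 0 < Real.log N)
    (hc : 1 ≤ c) (hα : α < 3 / 4 * √(2 * (N / m) * Real.log N)) :
    (poissonMeasure (N / m).toNNReal).real
        {k : ℕ | c * √(2 * (N / m) * Real.log N) - α < (k : ℝ) - (N / m).toNNReal} ≤
      8 / Real.log N := by
  set lam := N / m with hlam_def
  set l := Real.log N with hl_def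
  set t := √(2 * lam * l) with ht
  have ht2 : t ^ 2 = 2 * lam * l := Real.sq_sqrt (by positivity)
  have ht0 : 0 < t := Real.sqrt_pos.2 (by positivity)
  refine (poisson_real_le_div_sq _ (u := t / 4) (by positivity) fun k hk ↦ ?_).trans_eq ?_
  · refine le_abs.2 (Or.inl ?_)
    have : c * t - α < (k : ℝ) - lam.toNNReal := hk
    nlinarith
  · rw [Real.coe_toNNReal _ hlam.le, div_pow, ht2]
    field_simp
    norm_num

end FirstLevel

/-! ### A uniformly random order -/

section RandomOrder

/-- In any order of `V`, at most `#S - m` elements of `S` are preceded by at least `m` elements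
of `S`. -/
theorem card_filter_le_rank {V : Type*} {N : ℕ} (S : Finset V) (m : ℕ) (σ : V ≃ Fin N) :
    (S.filter fun f ↦ m ≤ (S.filter fun h ↦ σ h < σ f).card).card ≤ S.card - m := by
  rw [← Nat.card_Ico]
  refine Finset.card_le_card_of_injOn (fun f ↦ (S.filter fun h ↦ σ h < σ f).card) ?_ ?_
  · intro f hf
    obtain ⟨hfS, hfm⟩ := Finset.mem_filter.1 hf
    refine Finset.mem_coe.2 (Finset.mem_Ico.2 ⟨hfm, Finset.card_lt_card ?_⟩)
    exact Finset.filter_ssubset.2 ⟨f, hfS, lt_irrefl _⟩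
  · have mono : ∀ f ∈ S, ∀ f', σ f < σ f' →
        (S.filter fun h ↦ σ h < σ f).card < (S.filter fun h ↦ σ h < σ f').card := by
      intro f hf f' hff'
      refine Finset.card_lt_card ⟨fun h hh ↦ ?_, fun hsub ↦ ?_⟩
      · obtain ⟨h1, h2⟩ := Finset.mem_filter.1 hh
        exact Finset.mem_filter.2 ⟨h1, h2.trans hff'⟩
      · exact lt_irrefl _ (Finset.mem_filter.1 (hsub (Finset.mem_filter.2 ⟨hf, hff'⟩))).2
    intro f hf f' hf' heq
    have hfS := (Finset.mem_filter.1 hf).1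
    have hfS' := (Finset.mem_filter.1 hf').1
    rcases lt_trichotomy (σ f) (σ f') with h | h | h
    · exact absurd heq (mono f hfS f' h).ne
    · exact σ.injective h
    · exact absurd heq (mono f' hfS' f h).ne'

/-- The probability that a given element of `S` is not among the first `m` elements of `S` in a
random order. -/
theorem card_mul_prob_rank_le {V : Type*} [Fintype V] [DecidableEq V] {N : ℕ} (S : Finset V)
    (m : ℕ) {a : V} (ha : a ∈ S) :
    S.card * prob (fun σ : V ≃ Fin N ↦ m ≤ (S.filter fun h ↦ σ h < σ a).card) ≤
      ((S.card - m : ℕ) : ℝ) := by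
  -- By symmetry, all elements of `S` have the same probability.
  have hsymm : ∀ f ∈ S, prob (fun σ : V ≃ Fin N ↦ m ≤ (S.filter fun h ↦ σ h < σ f).card) =
      prob (fun σ : V ≃ Fin N ↦ m ≤ (S.filter fun h ↦ σ h < σ a).card) := by
    intro f hf
    rw [← prob_equiv (Equiv.equivCongr (Equiv.swap a f) (Equiv.refl (Fin N)))
      fun σ : V ≃ Fin N ↦ m ≤ (S.filter fun h ↦ σ h < σ a).card]
    congr 1
    funext σ
    have hswap : ∀ h, h ∈ S → Equiv.swap a f h ∈ S := fun h hh ↦ by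
      rw [Equiv.swap_apply_def]
      split_ifs <;> assumption
    have : (S.filter fun h ↦ σ h < σ f).card =
        (S.filter fun h ↦ (Equiv.equivCongr (Equiv.swap a f) (Equiv.refl (Fin N)) σ) h <
          (Equiv.equivCongr (Equiv.swap a f) (Equiv.refl (Fin N)) σ) a).card := by
      refine Finset.card_nbij' (Equiv.swap a f) (Equiv.swap a f) ?_ ?_ ?_ ?_
      · intro h hh
        obtain ⟨h1, h2⟩ := Finset.mem_filter.1 hh
        exact Finset.mem_filter.2 ⟨hswap h h1, by simpa using h2⟩
      · intro h hh
        obtain ⟨h1, h2⟩ := Finset.mem_filter.1 hh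
        exact Finset.mem_filter.2 ⟨hswap h h1, by simpa using h2⟩
      · intro h _
        simp
      · intro h _
        simp
    rw [this]
  rw [← nsmul_eq_mul, ← Finset.sum_const, ← Finset.sum_congr rfl hsymm]
  simp only [prob]
  rw [← Finset.expect_sum_comm]
  rcases isEmpty_or_nonempty (V ≃ Fin N) with hE | hE
  · simp
  refine (expect_mono (g := fun _ ↦ ((S.card - m : ℕ) : ℝ)) fun σ ↦ ?_).trans_eq
    (Fintype.expect_const _)
  classical
  refine le_trans (le_of_eq ?_) (Nat.cast_le.2 (card_filter_le_rank S m σ))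
  rw [← Finset.sum_boole]
  refine Finset.sum_congr rfl fun f _ ↦ ?_
  congr

end RandomOrder

/-! ### Uniformly random paths in the counter tree -/

section Paths

open Classical in
/-- The indicator of the paths that agree with `s` on the levels in `S`. -/
noncomputable def agree {m d : ℕ} (S : Finset (Fin d)) (s q : Fin d → Fin m) : ℝ :=
  if ∀ l ∈ S, q l = s l then 1 else 0

theorem isIndicator_agree {m d : ℕ} (hm : 0 < m) (S : Finset (Fin d)) (s : Fin d → Fin m) :
    IsIndicator (agree S s) (1 / (m : ℝ) ^ S.card) where
  zero_or_one q := by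
    rw [agree]
    split_ifs <;> simp
  expect_eq := by
    classical
    have : NeZero m := ⟨hm.ne'⟩
    have hprod : ∀ q, agree S s q = ∏ l, if l ∈ S → q l = s l then (1 : ℝ) else 0 := fun q ↦ by
      rw [agree, Finset.prod_boole]
      simp
    simp only [hprod]
    rw [expect_prod_eq fun l (b : Fin m) ↦ if l ∈ S → b = s l then (1 : ℝ) else 0,
      ← one_div_pow, ← Finset.prod_const, ← Finset.prod_subset (Finset.subset_univ S)]
    · refine Finset.prod_congr rfl fun l hl ↦ ?_
      simp [hl]
    · intro l _ hl
      simp [hl]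

/-- The indicator of the paths that run through the child `j` of the node which the path `g`
reaches at level `k`. -/
noncomputable def childInd {m d : ℕ} (g : Fin d → Fin m) (k : Fin d) (j : Fin m) :
    (Fin d → Fin m) → ℝ :=
  agree (Finset.Iic k) (Function.update g k j)

theorem isIndicator_childInd {m d : ℕ} (hm : 0 < m) (g : Fin d → Fin m) (k : Fin d) (j : Fin m) :
    IsIndicator (childInd g k j) (1 / (m : ℝ) ^ ((k : ℕ) + 1)) := by
  have := isIndicator_agree hm (Finset.Iic k) (Function.update g k j)
  rwa [Fin.card_Iic] at this

open Classical in
theorem childInd_eq {m d : ℕ} (g : Fin d → Fin m) (k : Fin d) (j : Fin m) (q : Fin d → Fin m) :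
    childInd g k j q = if (∀ i < k, q i = g i) ∧ q k = j then 1 else 0 := by
  rw [childInd, agree]
  congr 1
  refine propext ⟨fun h ↦ ⟨fun i hi ↦ ?_, ?_⟩, fun h l hl ↦ ?_⟩
  · rw [h i (Finset.mem_Iic.2 hi.le), Function.update_of_ne hi.ne]
  · rw [h k (Finset.mem_Iic.2 le_rfl), Function.update_self]
  · rcases eq_or_lt_of_le (Finset.mem_Iic.1 hl) with rfl | hlt
    · rw [h.2, Function.update_self]
    · rw [h.1 l hlt, Function.update_of_ne hlt.ne]

/-- In the node of the path `g` at level `k`, the attack flow (of volume `α`, hashed to `g`) has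
the strictly largest counter, if the legitimate flows have volumes `x` and paths `H`. -/
def Wins {m d n : ℕ} (g : Fin d → Fin m) (α : ℝ) (x : Fin n → ℝ) (k : Fin d)
    (H : Fin n → Fin d → Fin m) : Prop :=
  ∀ j ≠ g k, ∑ i, x i * childInd g k j (H i) < α + ∑ i, x i * childInd g k (g k) (H i)

/-- Chebyshev's inequality for the difference of two counters. Below the first period it is
enough, because the traffic decreases geometrically with the level. -/
theorem prob_not_wins_le {m d n : ℕ} (hm : 0 < m) (g : Fin d → Fin m) {α N : ℝ} (hα : 0 < α)
    {x : Fin n → ℝ} (hx : ∀ i, 0 ≤ x i) (hx1 : ∀ i, x i ≤ 1) (hN : ∑ i, x i ≤ N) (k : Fin d) :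
    prob (fun H : Fin n → Fin d → Fin m ↦ ¬ Wins g α x k H) ≤
      2 * N / α ^ 2 * (1 / (m : ℝ)) ^ (k : ℕ) := by
  have : NeZero m := ⟨hm.ne'⟩
  have hm0 : (0 : ℝ) < m := Nat.cast_pos.2 hm
  have hone : ∀ j, prob (fun H : Fin n → Fin d → Fin m ↦
      α ≤ |∑ i, x i * (childInd g k j (H i) - childInd g k (g k) (H i))|) ≤
      2 * N / m ^ ((k : ℕ) + 1) / α ^ 2 := by
    intro j
    have Ij := isIndicator_childInd hm g k j
    have Ig := isIndicator_childInd hm g k (g k)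
    refine (prob_le_expect_sq_div hα fun H h ↦ h).trans ?_
    rw [expect_sum_sq fun i q ↦ x i * (childInd g k j q - childInd g k (g k) q)]
    · gcongr
      calc ∑ i, 𝔼 q, (x i * (childInd g k j q - childInd g k (g k) q)) ^ 2
          ≤ ∑ i, 𝔼 q, x i * (childInd g k j q + childInd g k (g k) q) := by
            refine Finset.sum_le_sum fun i _ ↦ expect_mono fun q ↦ ?_
            have hxx : x i ^ 2 ≤ x i := by nlinarith [hx i, hx1 i]
            have := hx i
            rcases Ij.zero_or_one q with h | h <;> rcases Ig.zero_or_one q with h' | h' <;>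
              rw [h, h'] <;> nlinarith
        _ = (∑ i, x i) * (2 / m ^ ((k : ℕ) + 1)) := by
            rw [Finset.sum_mul]
            refine Finset.sum_congr rfl fun i _ ↦ ?_
            rw [← Finset.mul_expect, Finset.expect_add_distrib, Ij.expect_eq, Ig.expect_eq]
            ring
        _ ≤ N * (2 / m ^ ((k : ℕ) + 1)) := by gcongr
        _ = _ := by ring
    · intro i
      rw [← Finset.mul_expect, Finset.expect_sub_distrib, Ij.expect_eq, Ig.expect_eq, sub_self,
        mul_zero]
  calc prob (fun H : Fin n → Fin d → Fin m ↦ ¬ Wins g α x k H)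
      ≤ prob (fun H : Fin n → Fin d → Fin m ↦ ∃ j ∈ Finset.univ,
          α ≤ |∑ i, x i * (childInd g k j (H i) - childInd g k (g k) (H i))|) := by
        refine prob_mono fun H hH ↦ ?_
        simp only [Wins, not_forall, not_lt] at hH
        obtain ⟨j, -, hj⟩ := hH
        refine ⟨j, Finset.mem_univ j, le_abs.2 (Or.inl ?_)⟩
        simp only [mul_sub, Finset.sum_sub_distrib]
        linarith
    _ ≤ ∑ j : Fin m, 2 * N / m ^ ((k : ℕ) + 1) / α ^ 2 :=
        (prob_exists_le _ _).trans (Finset.sum_le_sum fun j _ ↦ hone j)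
    _ = _ := by
        rw [Finset.sum_const, Finset.card_univ, Fintype.card_fin, nsmul_eq_mul, one_div_pow,
          pow_succ]
        field_simp

theorem prob_exists_not_wins_le {m d n : ℕ} (hm : 2 ≤ m) (g : Fin (d + 1) → Fin m) {α N : ℝ}
    (hα : 0 < α) {x : Fin (d + 1) → Fin n → ℝ} (hx : ∀ k i, 0 ≤ x k i) (hx1 : ∀ k i, x k i ≤ 1)
    (hN : ∀ k, ∑ i, x k i ≤ N) :
    prob (fun H : Fin n → Fin (d + 1) → Fin m ↦ ∃ k ∈ Finset.univ,
      ¬ Wins g α (x (Fin.succ k)) (Fin.succ k) H) ≤ 4 * (N / m) / α ^ 2 := by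
  have hm2 : (2 : ℝ) ≤ m := by exact_mod_cast hm
  have hr : 1 / (m : ℝ) ≤ 1 / 2 := by gcongr
  have hr0 : 0 ≤ 1 / (m : ℝ) := by positivity
  have hN0 : 0 ≤ N := (Finset.sum_nonneg fun i _ ↦ hx 0 i).trans (hN 0)
  have hgeom : ∑ k : Fin d, (1 / (m : ℝ)) ^ (k : ℕ) ≤ 2 := by
    rw [Fin.sum_univ_eq_sum_range fun k ↦ (1 / (m : ℝ)) ^ k]
    refine ((summable_geometric_of_lt_one hr0 (by linarith)).sum_le_tsum _
      fun k _ ↦ by positivity).trans ?_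
    rw [tsum_geometric_of_lt_one hr0 (by linarith), inv_le_comm₀ (by linarith) (by norm_num)]
    linarith
  calc _ ≤ ∑ k : Fin d, 2 * N / α ^ 2 * (1 / (m : ℝ)) ^ ((k : ℕ) + 1) :=
        (prob_exists_le _ _).trans (Finset.sum_le_sum fun k _ ↦
          prob_not_wins_le (by omega) g hα (hx _) (hx1 _) (hN _) _)
    _ = 2 * N / α ^ 2 * (1 / m) * ∑ k : Fin d, (1 / (m : ℝ)) ^ (k : ℕ) := by
        rw [Finset.mul_sum]
        exact Finset.sum_congr rfl fun k _ ↦ by ring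
    _ ≤ 2 * N / α ^ 2 * (1 / m) * 2 := by gcongr
    _ = _ := by ring

end Paths

/-! ### From the events to the detector -/

section Detector

/-- The paths of all flows, given the one of the attack flow and those of the legitimate flows. -/
def joinPath {n m d : ℕ} (g : Fin d → Fin m) (H : Fin n → Fin d → Fin m) :
    Flow n → Fin d → Fin m
  | none => g
  | some i => H i

variable {n m d : ℕ}

theorem counterValue_joinPath {γ : ℝ} (hγ : γ ≠ 0) (α T : ℝ) (r : Fin d → Fin n → ℝ)
    (g : Fin d → Fin m) (H : Fin n → Fin d → Fin m) (k : Fin d) (j : Fin m) :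
    counterValue (volume γ α T r) (joinPath g H) g k j =
      γ * T * ((if g k = j then α else 0) + ∑ i, r k i / γ * childInd g k j (H i)) := by
  classical
  rw [counterValue, Fintype.sum_option, mul_add, Finset.mul_sum]
  congr 1
  · by_cases h : g k = j
    · simp [joinPath, volume, h]
      ring
    · simp [joinPath, h]
  · refine Finset.sum_congr rfl fun i _ ↦ ?_
    rw [childInd_eq]
    by_cases h : (∀ l < k, H i l = g l) ∧ H i k = j
    · rw [if_pos h, if_pos (by exact h), volume]
      field_simp
    · rw [if_neg h, if_neg (by exact h)]
      ring

/-- If the attack flow has the strictly largest counter in every node on its own path, then the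
detector follows this path, however ties are broken. -/
theorem IsRun.eq_of_wins {γ α T : ℝ} (hγ : 0 < γ) (hT : 0 < T) {r : Fin d → Fin n → ℝ}
    {g : Fin d → Fin m} {H : Fin n → Fin d → Fin m}
    (hw : ∀ k : Fin d, (k : ℕ) + 1 < d → Wins g α (fun i ↦ r k i / γ) k H) {s : Fin d → Fin m}
    (hs : IsRun (volume γ α T r) (joinPath g H) s) (k : Fin d) (hk : (k : ℕ) + 1 < d) :
    s k = g k := by
  classical
  induction k using WellFoundedLT.induction with
  | ind k ih =>
    have hsg : ∀ j, counterValue (volume γ α T r) (joinPath g H) s k j =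
        counterValue (volume γ α T r) (joinPath g H) g k j := by
      intro j
      rw [counterValue, counterValue]
      refine Finset.sum_congr rfl fun f _ ↦ ?_
      congr 2
      refine propext (forall₂_congr fun i hi ↦ ?_)
      rw [ih i hi (by have : (i : ℕ) < k := hi; omega)]
    by_contra hne
    have h1 := hs k hk (g k)
    rw [hsg, hsg, counterValue_joinPath hγ.ne', counterValue_joinPath hγ.ne', if_pos rfl,
      if_neg (Ne.symm hne), zero_add] at h1
    exact absurd (le_of_mul_le_mul_left h1 (by positivity)) (not_le.2 (hw k hk (s k) hne))

/-- The indicator of the paths that run through the bottom node of the path `g`. -/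
noncomputable def bottomInd (g : Fin d → Fin m) : (Fin d → Fin m) → ℝ :=
  agree (Finset.univ.filter fun k : Fin d ↦ (k : ℕ) + 1 < d) g

open Classical in
/-- The attack flow gets a dedicated counter in the bottom node of its path `g`, with high
probability: on average at most `m` other flows reach this node. -/
theorem prob_not_dedicated_le {g : Fin (d + 1) → Fin m} (hm : 0 < m) (hn : n ≤ m ^ (d + 1)) :
    prob (fun ω : (Fin n → Fin (d + 1) → Fin m) × (Flow n ≃ Fin (n + 1)) ↦
      ¬ {f ∈ bottomFlows (joinPath g ω.1) g | ω.2 f < ω.2 none}.ncard < m) ≤ 2 / √(m : ℝ) := by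
  have : NeZero m := ⟨hm.ne'⟩
  have hm0 : (0 : ℝ) < m := Nat.cast_pos.2 hm
  have hm1 : (1 : ℝ) ≤ m := by exact_mod_cast hm
  set ρ := √(m : ℝ) with hρ
  have hρ0 : 0 < ρ := Real.sqrt_pos.2 hm0
  have hρ2 : ρ * ρ = m := Real.mul_self_sqrt hm0.le
  set q : ℝ := 1 / (m : ℝ) ^ d with hq
  have hq0 : 0 ≤ q := by positivity
  have hI : IsIndicator (bottomInd g) q := by
    have := isIndicator_agree hm (Finset.univ.filter fun k : Fin (d + 1) ↦ (k : ℕ) + 1 < d + 1) g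
    have hcard : (Finset.univ.filter fun k : Fin (d + 1) ↦ (k : ℕ) + 1 < d + 1).card = d := by
      simp only [Nat.add_lt_add_iff_right]
      rw [Fin.card_filter_val_lt]
      simp
    rwa [hcard] at this
  have hnq : n * q ≤ m := by
    rw [hq, mul_one_div, div_le_iff₀ (by positivity), ← pow_succ']
    exact_mod_cast hn
  set Y : (Fin n → Fin (d + 1) → Fin m) → ℝ := fun H ↦ ∑ i, 1 * (bottomInd g (H i) - q) with hY
  have hYsq : 𝔼 H, Y H ^ 2 ≤ m := by
    refine (hI.expect_sum_sq_le fun _ : Fin n ↦ 1).trans (le_trans (le_of_eq ?_) hnq)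
    simp [mul_comm]
  have hcond : ∀ H : Fin n → Fin (d + 1) → Fin m, prob (fun σ : Flow n ≃ Fin (n + 1) ↦
      ¬ {f ∈ bottomFlows (joinPath g H) g | σ f < σ none}.ncard < m) ≤
      (1 + (ρ + Y H ^ 2 / ρ) / 2) / m := by
    intro H
    set S : Finset (Flow n) :=
      Finset.univ.filter fun f ↦ f ∈ bottomFlows (joinPath g H) g with hS
    have hnone : none ∈ S := by simp [hS, bottomFlows, joinPath]
    have hScard : (S.card : ℝ) = 1 + (Y H + n * q) := by
      have hsum : (S.card : ℝ) = ∑ f : Flow n, bottomInd g (joinPath g H f) := by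
        rw [hS, Finset.card_filter]
        push_cast
        refine Finset.sum_congr rfl fun f _ ↦ ?_
        rw [bottomInd, agree]
        simp [bottomFlows]
      rw [hsum, Fintype.sum_option, hY]
      simp [joinPath, bottomInd, agree]
    have hncard : ∀ σ : Flow n ≃ Fin (n + 1),
        {f ∈ bottomFlows (joinPath g H) g | σ f < σ none}.ncard =
          (S.filter fun h ↦ σ h < σ none).card := fun σ ↦ by
      rw [← Set.ncard_coe_finset]
      congr 1
      ext f
      simp [hS]
    simp only [hncard, not_lt]
    have h := card_mul_prob_rank_le (N := n + 1) S m hnone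
    set P := prob (fun σ : Flow n ≃ Fin (n + 1) ↦ m ≤ (S.filter fun h ↦ σ h < σ none).card)
    have hP0 : 0 ≤ P := prob_nonneg _
    have hYY : Y H ≤ (ρ + Y H ^ 2 / ρ) / 2 := by
      rw [le_div_iff₀ (by norm_num), ← sub_nonneg, show ρ + Y H ^ 2 / ρ - Y H * 2 =
        (Y H - ρ) ^ 2 / ρ by field_simp; ring]
      positivity
    have hYpos : 0 ≤ (ρ + Y H ^ 2 / ρ) / 2 := by positivity
    rw [le_div_iff₀ hm0]
    rcases le_total S.card m with hSm | hSm
    · rw [Nat.sub_eq_zero_of_le hSm, Nat.cast_zero] at h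
      have hS1 : (0 : ℝ) < S.card := by exact_mod_cast Finset.card_pos.2 ⟨_, hnone⟩
      have : P ≤ 0 := by
        by_contra! hP
        exact absurd h (not_le.2 (mul_pos hS1 hP))
      nlinarith
    · rw [Nat.cast_sub hSm, hScard] at h
      have hSm' : (m : ℝ) ≤ 1 + (Y H + n * q) := by rw [← hScard]; exact_mod_cast hSm
      nlinarith
  rw [prob_prod]
  refine (expect_mono hcond).trans ?_
  rw [← Finset.expect_div, Finset.expect_add_distrib, ← Finset.expect_div,
    Finset.expect_add_distrib, Fintype.expect_const, Fintype.expect_const, ← Finset.expect_div]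
  calc (1 + (ρ + (𝔼 H, Y H ^ 2) / ρ) / 2) / m ≤ (1 + (ρ + m / ρ) / 2) / m := by gcongr
    _ = (1 + ρ) / m := by rw [← hρ2]; field_simp; ring
    _ ≤ (ρ + ρ) / m := by
        gcongr
        exact Real.one_le_sqrt.2 hm1
    _ = 2 / ρ := by rw [← hρ2]; field_simp; norm_num

/-- The paths and the order, with the path of the attack flow split off. -/
def randomnessEquiv (n m d : ℕ) : (Fin d → Fin m) ×
    ((Fin n → Fin d → Fin m) × (Flow n ≃ Fin (n + 1))) ≃ Randomness n m d :=
  (Equiv.prodAssoc _ _ _).symm.trans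
    (Equiv.prodCongr (Equiv.piOptionEquivProd (β := fun _ ↦ Fin d → Fin m)).symm (Equiv.refl _))

theorem randomnessEquiv_fst (g : Fin d → Fin m) (H : Fin n → Fin d → Fin m)
    (σ : Flow n ≃ Fin (n + 1)) :
    randomnessEquiv n m d (g, H, σ) = (joinPath g H, σ) := by
  refine Prod.ext (funext fun f ↦ ?_) rfl
  cases f <;> rfl

/-- The total detection probability, up to the failures below the first period. -/
theorem le_detectionProb {γ β T α N w : ℝ} {r : Fin (d + 1) → Fin n → ℝ} (hγ : 0 < γ) (hT : 0 < T)
    (hα : 0 < α) (hβ : γ * T + β < α * γ * T) (hm : 2 ≤ m) (hn : n ≤ m ^ (d + 1))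
    (hr : ∀ k i, 0 ≤ r k i) (hr1 : ∀ k i, r k i / γ ≤ 1) (hN : ∀ k, ∑ i, r k i / γ ≤ N)
    (hw : ∀ g : Fin (d + 1) → Fin m, w ≤ prob (Wins g α (fun i ↦ r 0 i / γ) 0)) :
    w ≤ detectionProb m γ β T α r + (4 * (N / m) / α ^ 2 + 2 / √(m : ℝ)) := by
  have : NeZero m := ⟨by omega⟩
  rw [detectionProb, ncard_div_card, ← prob_equiv (randomnessEquiv n m (d + 1)), prob_prod,
    ← sub_le_iff_le_add, ← Fintype.expect_const (ι := Fin (d + 1) → Fin m) (w - _)]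
  refine expect_mono fun g ↦ ?_
  rw [sub_le_iff_le_add]
  have hbelow := prob_exists_not_wins_le hm g hα (fun k i ↦ div_nonneg (hr k i) hγ.le) hr1 hN
  have hded := prob_not_dedicated_le (g := g) (by omega : 0 < m) hn
  have hne : Nonempty (Flow n ≃ Fin (n + 1)) := ⟨Fintype.equivFinOfCardEq (by simp)⟩
  rw [← prob_comp_fst (Ω' := Flow n ≃ Fin (n + 1))] at hbelow
  refine (hw g).trans ?_
  rw [← prob_comp_fst (Ω' := Flow n ≃ Fin (n + 1))]
  refine le_trans ?_ (add_le_add_right (add_le_add hbelow hded) _)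
  refine le_trans (prob_mono ?_) ((prob_or_le _ _).trans (add_le_add_right (prob_or_le _ _) _))
  rintro ⟨H, σ⟩ h0
  by_contra! hcon
  obtain ⟨hnot, hall, hlt⟩ := hcon
  have hwins : ∀ k : Fin (d + 1), (k : ℕ) + 1 < d + 1 → Wins g α (fun i ↦ r k i / γ) k H :=
    fun k _ ↦ Fin.cases h0 (fun k ↦ hall k (Finset.mem_univ k)) k
  refine hnot ?_
  rw [randomnessEquiv_fst]
  refine ⟨fun s hs ↦ ?_, hβ⟩
  have heq := fun k hk ↦ hs.eq_of_wins hγ hT hwins k hk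
  have hbot : bottomFlows (joinPath g H) s = bottomFlows (joinPath g H) g := by
    ext f
    exact forall₂_congr fun k hk ↦ by rw [heq k hk]
  simp only [hbot]
  exact ⟨fun k _ ↦ rfl, hlt⟩

end Detector

/-! ### The growth of the load -/

section Growth

open Filter

/-- If the load per counter exceeds `log m` by a large factor, then it exceeds `log N` by a large
factor. -/
theorem exists_log_le_mul_load (D κ : ℝ) (hκ : 0 < κ) : ∃ C : ℝ, ∀ (m : ℕ) (N : ℝ), C ≤ m →
    C * (m * Real.log m) ≤ N →
    1 ≤ Real.log m ∧ D ≤ m ∧ D ≤ N / m ∧ D ≤ Real.log N ∧ Real.log N ≤ κ * (N / m) := by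
  obtain ⟨x₀, hx₀⟩ := eventually_atTop.1 (Real.isLittleO_log_id_atTop.bound (half_pos hκ))
  refine ⟨max (max (Real.exp 1) (Real.exp D)) (max (max D x₀) (2 / κ)), fun m N hm hN ↦ ?_⟩
  set C := max (max (Real.exp 1) (Real.exp D)) (max (max D x₀) (2 / κ)) with hC
  have c1 : Real.exp 1 ≤ C := (le_max_left _ _).trans (le_max_left _ _)
  have c2 : Real.exp D ≤ C := (le_max_right _ _).trans (le_max_left _ _)
  have c3 : D ≤ C := (le_max_left _ _).trans ((le_max_left _ _).trans (le_max_right _ _))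
  have c4 : x₀ ≤ C := (le_max_right _ _).trans ((le_max_left _ _).trans (le_max_right _ _))
  have c5 : 2 / κ ≤ C := (le_max_right _ _).trans (le_max_right _ _)
  have hC1 : 1 ≤ C := by linarith [Real.add_one_le_exp 1]
  have hm0 : (0 : ℝ) < m := by linarith
  have hlm : 1 ≤ Real.log m := (Real.le_log_iff_exp_le hm0).2 (c1.trans hm)
  have hlam : C * Real.log m ≤ N / m := by
    rw [le_div_iff₀ hm0]
    linarith
  have hlamC : C ≤ N / m := le_trans (le_mul_of_one_le_right (by linarith) hlm) hlam
  have hlam0 : 0 < N / m := by linarith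
  have hlog : Real.log N = Real.log m + Real.log (N / m) := by
    rw [← Real.log_mul hm0.ne' hlam0.ne', mul_div_cancel₀ _ hm0.ne']
  have hlog0 : 0 ≤ Real.log (N / m) := Real.log_nonneg (by linarith)
  refine ⟨hlm, c3.trans hm, c3.trans hlamC, ?_, ?_⟩
  · have := (Real.le_log_iff_exp_le hm0).2 (c2.trans hm)
    linarith
  · have h1 := hx₀ (N / m) (c4.trans hlamC)
    rw [Real.norm_of_nonneg hlog0, id, Real.norm_of_nonneg hlam0.le] at h1
    have h2 : Real.log m ≤ κ / 2 * (N / m) := by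
      have h3 : 2 / κ * Real.log m ≤ N / m :=
        (mul_le_mul_of_nonneg_right c5 (by linarith)).trans hlam
      calc Real.log m = κ / 2 * (2 / κ * Real.log m) := by field_simp
        _ ≤ κ / 2 * (N / m) := by gcongr
    linarith

theorem exists_log_cube_le_load : ∃ C : ℝ, ∀ (m : ℕ) (N : ℝ), C ≤ m →
    C * (m * Real.log m ^ 3) ≤ N → Real.log N ^ 3 ≤ N / m := by
  obtain ⟨x₀, hx₀⟩ := eventually_atTop.1
    ((Real.isLittleO_pow_log_id_atTop (n := 3)).bound (show (0 : ℝ) < 1 / 8 by norm_num))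
  refine ⟨max (max (Real.exp 1) 8) x₀, fun m N hm hN ↦ ?_⟩
  set C := max (max (Real.exp 1) 8) x₀ with hC
  have c1 : Real.exp 1 ≤ C := (le_max_left _ _).trans (le_max_left _ _)
  have c2 : 8 ≤ C := (le_max_right _ _).trans (le_max_left _ _)
  have c3 : x₀ ≤ C := le_max_right _ _
  have hm0 : (0 : ℝ) < m := by linarith
  have hlm : 1 ≤ Real.log m := (Real.le_log_iff_exp_le hm0).2 (c1.trans hm)
  have hlam : C * Real.log m ^ 3 ≤ N / m := by
    rw [le_div_iff₀ hm0]
    linarith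
  have hlamC : C ≤ N / m :=
    le_trans (le_mul_of_one_le_right (by linarith) (one_le_pow₀ hlm)) hlam
  have hlam0 : 0 < N / m := by linarith
  have hlog : Real.log N = Real.log m + Real.log (N / m) := by
    rw [← Real.log_mul hm0.ne' hlam0.ne', mul_div_cancel₀ _ hm0.ne']
  have hlog0 : 0 ≤ Real.log (N / m) := Real.log_nonneg (by linarith)
  have h1 := hx₀ (N / m) (c3.trans hlamC)
  rw [Real.norm_of_nonneg (by positivity), id, Real.norm_of_nonneg hlam0.le] at h1
  have h2 : 8 * Real.log m ^ 3 ≤ N / m :=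
    (mul_le_mul_of_nonneg_right c2 (by positivity)).trans hlam
  have h3 := add_pow_le (by linarith : 0 ≤ Real.log m) hlog0 3
  norm_num at h3
  rw [hlog]
  linarith

end Growth

/-! ### The detection bound -/

section Bound

open MeasureTheory ProbabilityTheory
open scoped NNReal

theorem one_sub_Q_K (c : ℝ) (m : ℕ) {N : ℝ} (hlam : 0 ≤ N / m) (α : ℝ) :
    1 - Q (K c m N α) (N / m) = (poissonMeasure (N / m).toNNReal).real
      {k : ℕ | c * √(2 * (N / m) * Real.log N) - α < (k : ℝ) - (N / m).toNNReal} := by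
  rw [Q, ← probReal_compl_eq_one_sub .of_discrete]
  congr 1
  ext k
  rw [Set.mem_compl_iff, Set.mem_ofPred_eq, Set.mem_ofPred_eq, Real.coe_toNNReal _ hlam, K,
    ← Int.cast_natCast (R := ℝ) k, Int.cast_le, Int.le_floor, not_le, sub_lt_iff_lt_add,
    lt_sub_iff_add_lt]
  constructor <;> intro h <;> linarith

theorem totalBound_le (c : ℝ) (m n : ℕ) (nγ α : ℝ) :
    totalBound c m n nγ α ≤ 1 - Q (K c m (min (n : ℝ) nγ) α) (min (n : ℝ) nγ / m) := by
  rw [totalBound]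
  split_ifs with h
  · rw [min_eq_right h]
    refine pow_le_of_le_one ?_ ?_ (Nat.succ_ne_zero _)
    · exact sub_nonneg.2 measureReal_le_one
    · exact sub_le_self _ measureReal_nonneg
  · rw [min_eq_left (not_le.1 h).le]

/-- The detection bound under the conditions on the load that the argument uses: `log N` is at
most a small multiple of the load `N / m`, and the third order term in Bernstein's inequality is
bounded, or absorbed by a factor `c > 1`. -/
theorem exists_totalBound_le_detectionProb (b : ℝ) {ε : ℝ} (hε : 0 < ε) : ∃ C : ℝ,
    ∀ (m n d : ℕ) (γ ρ β T α c : ℝ) (r : Fin d → Fin n → ℝ),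
      0 < γ → 0 < T → β ≤ b * (γ * T) → IsLegitimate γ ρ r → 1 ≤ c → C ≤ m → Nat.clog m n ≤ d →
      C ≤ min (n : ℝ) (ρ / γ) / m → C ≤ Real.log (min (n : ℝ) (ρ / γ)) →
      32 * c ^ 2 * Real.log (min (n : ℝ) (ρ / γ)) ≤ min (n : ℝ) (ρ / γ) / m →
      3 * c ^ 3 * Real.log (min (n : ℝ) (ρ / γ)) *
        √(Real.log (min (n : ℝ) (ρ / γ)) / (min (n : ℝ) (ρ / γ) / m)) ≤
        (c ^ 2 - 1) * Real.log (min (n : ℝ) (ρ / γ)) + 3 →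
      totalBound c m n (ρ / γ) α - ε ≤ detectionProb m γ β T α r := by
  obtain ⟨C₁, hC₁⟩ := exists_poisson_tail_le_prob_win (half_pos hε)
  set C := max (max C₁ (b + 2)) (max (16 / ε) (max 2 ((8 / ε) ^ 2))) with hC
  have c1 : C₁ ≤ C := (le_max_left _ _).trans (le_max_left _ _)
  have c2 : b + 2 ≤ C := (le_max_right _ _).trans (le_max_left _ _)
  have c3 : 16 / ε ≤ C := (le_max_left _ _).trans (le_max_right _ _)
  have c4 : 2 ≤ C := (le_max_left _ _).trans ((le_max_right _ _).trans (le_max_right _ _))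
  have c5 : (8 / ε) ^ 2 ≤ C :=
    (le_max_right _ _).trans ((le_max_right _ _).trans (le_max_right _ _))
  refine ⟨C, ?_⟩
  intro m n d γ ρ β T α c r hγ hT hβb hr hc hCm hd hClam hCl hlc hB
  set N := min (n : ℝ) (ρ / γ) with hN
  set l := Real.log N with hl_def
  have hm2 : (2 : ℝ) ≤ m := c4.trans hCm
  have hm2' : 2 ≤ m := by exact_mod_cast hm2
  have hlam0 : 0 < N / m := by linarith
  have hl0 : 0 < l := by linarith
  have hle := totalBound_le c m n (ρ / γ) α
  rw [← hN, one_sub_Q_K c m hlam0.le] at hle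
  have hl16 : 16 / l ≤ ε := by
    rw [div_le_iff₀ hl0, ← div_le_iff₀' hε]
    exact c3.trans hCl
  rcases lt_or_ge α (3 / 4 * √(2 * (N / m) * l)) with hα | hα
  · have h1 := poisson_tail_le_of_lt hlam0 hl0 hc hα
    have h2 : 8 / l ≤ 16 / l := by gcongr; norm_num
    have h3 : 0 ≤ detectionProb m γ β T α r := by rw [detectionProb]; positivity
    linarith
  · have hα0 : 0 ≤ α := le_trans (by positivity) hα
    have hα2 : 9 / 8 * (N / m) * l ≤ α ^ 2 := by
      have h := pow_le_pow_left₀ (by positivity) hα 2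
      rw [mul_pow, Real.sq_sqrt (by positivity)] at h
      linarith
    have hαC : C ≤ α := by
      have h1 : C * C ≤ N / m * l := mul_le_mul hClam hCl (by linarith) hlam0.le
      nlinarith
    have hαpos : 0 < α := by linarith
    have hβ : γ * T + β < α * γ * T := by
      have : 0 < γ * T := mul_pos hγ hT
      nlinarith
    have hn : n ≤ m ^ d := (Nat.le_pow_clog (by omega) n).trans (Nat.pow_le_pow_right (by omega) hd)
    have hx1 : ∀ k i, r k i / γ ≤ 1 := fun k i ↦ (div_le_one hγ).2 (hr.le_threshold k i)
    have hxN : ∀ k, ∑ i, r k i / γ ≤ N := fun k ↦ by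
      refine le_min ?_ ?_
      · simpa using Finset.sum_le_sum fun i (_ : i ∈ Finset.univ) ↦ hx1 k i
      · rw [← Finset.sum_div]
        gcongr
        exact hr.sum_le_link k
    obtain _ | d := d
    · -- The number of levels is positive, since `n` is at least `2`.
      have h1 : (n : ℝ) ≤ 1 := by exact_mod_cast (pow_zero m ▸ hn)
      have h2 : N ≤ 1 := (min_le_left _ _).trans h1
      have h3 : N / m ≤ 1 := (div_le_one (by linarith)).2 (by linarith)
      linarith
    have hNe : NeZero m := ⟨by omega⟩
    have key := le_detectionProb (w := (poissonMeasure (N / m).toNNReal).real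
        {k : ℕ | c * √(2 * (N / m) * l) - α < (k : ℝ) - (N / m).toNNReal} - ε / 2)
      hγ hT hαpos hβ hm2' hn hr.nonneg hx1 hxN fun g ↦ by
        rw [sub_le_iff_le_add]
        exact hC₁ (J := childInd g 0) (fun j ↦ by simpa using isIndicator_childInd (by omega) g 0 j)
          (g 0) (fun i ↦ div_nonneg (hr.nonneg 0 i) hγ.le) (hx1 0) (hxN 0) hc (c1.trans hCm)
          (c1.trans hClam) (c1.trans hCl) hlc hB hα
    have e1 : 4 * (N / m) / α ^ 2 ≤ ε / 4 := by
      have h1 : 4 * (N / m) / α ^ 2 ≤ 4 / l := by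
        rw [div_le_div_iff₀ (by positivity) hl0]
        nlinarith
      have h2 : 4 / l = 16 / l / 4 := by ring
      linarith
    have e2 : 2 / √(m : ℝ) ≤ ε / 4 := by
      have h1 : 8 / ε ≤ √(m : ℝ) := Real.le_sqrt_of_sq_le (c5.trans hCm)
      rw [div_le_iff₀ (Real.sqrt_pos.2 (by linarith))]
      rw [div_le_iff₀ hε] at h1
      linarith
    linarith

end Bound

end RLFD

theorem mainTheorem4 (b c ε : ℝ) (hc : 1 < c) (hε : 0 < ε) :
    ∃ C : ℝ, ∀ (m n d : ℕ) (γ ρ β T α : ℝ) (r : Fin d → Fin n → ℝ),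
      0 < γ → 0 ≤ β → 0 < T → β ≤ b * (γ * T) → 1 < α →
      RLFD.IsLegitimate γ ρ r →
      C ≤ m → Nat.clog m n ≤ d →
      (C * (m * Real.log m ^ 3) ≤ min (n : ℝ) (ρ / γ) →
        RLFD.totalBound 1 m n (ρ / γ) α - ε ≤ RLFD.detectionProb m γ β T α r) ∧
      (C * (m * Real.log m) ≤ min (n : ℝ) (ρ / γ) →
        RLFD.totalBound c m n (ρ / γ) α - ε ≤ RLFD.detectionProb m γ β T α r) := by
  obtain ⟨C₁, h₁⟩ := RLFD.exists_totalBound_le_detectionProb b hε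
  have hc2 : 0 < c ^ 2 - 1 := by nlinarith
  have hc0 : 0 < c := by linarith
  set κ := min (1 / (32 * c ^ 2)) (((c ^ 2 - 1) / (3 * c ^ 3)) ^ 2) with hκ
  have hκ0 : 0 < κ := lt_min (by positivity) (by positivity)
  obtain ⟨C₂, h₂⟩ := RLFD.exists_log_le_mul_load (max C₁ 6) κ hκ0
  obtain ⟨C₃, h₃⟩ := RLFD.exists_log_cube_le_load
  refine ⟨max (max C₂ C₃) 0, ?_⟩
  set C := max (max C₂ C₃) 0 with hC
  have c2 : C₂ ≤ C := (le_max_left _ _).trans (le_max_left _ _)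
  have c3 : C₃ ≤ C := (le_max_right _ _).trans (le_max_left _ _)
  have c0 : 0 ≤ C := le_max_right _ _
  intro m n d γ ρ β T α r hγ _ hT hβb _ hr hCm hd
  have hlog0 : 0 ≤ Real.log m := Real.log_natCast_nonneg m
  constructor
  · intro hN
    have hN3 : C₃ * (m * Real.log m ^ 3) ≤ min (n : ℝ) (ρ / γ) :=
      (mul_le_mul_of_nonneg_right c3 (by positivity)).trans hN
    have hcube := h₃ m _ (c3.trans hCm) hN3
    -- `log m` is at most its cube because it is at least `1`.
    have hlm : 1 ≤ Real.log m :=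
      (h₂ m (C₂ * (m * Real.log m)) (c2.trans hCm) le_rfl).1
    have hN2 : C₂ * (m * Real.log m) ≤ min (n : ℝ) (ρ / γ) := by
      refine (mul_le_mul_of_nonneg_right c2 (by positivity)).trans (le_trans ?_ hN)
      gcongr
      exact le_self_pow₀ hlm (by norm_num)
    obtain ⟨-, d1, d2, d3, -⟩ := h₂ m _ (c2.trans hCm) hN2
    set N := min (n : ℝ) (ρ / γ)
    set l := Real.log N
    have hl6 : 6 ≤ l := (le_max_right _ _).trans d3
    have hlam6 : 6 ≤ N / m := (le_max_right _ _).trans d2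
    refine h₁ m n d γ ρ β T α 1 r hγ hT hβb hr le_rfl ((le_max_left _ _).trans d1) hd
      ((le_max_left _ _).trans d2) ((le_max_left _ _).trans d3) ?_ ?_
    · nlinarith [mul_le_mul hl6 hl6 (by norm_num) (by linarith)]
    · have hsq : l * √(l / (N / m)) ≤ 1 := by
        rw [← Real.sqrt_sq (show 0 ≤ l by linarith), ← Real.sqrt_mul (sq_nonneg _),
          Real.sqrt_sq (show 0 ≤ l by linarith)]
        refine Real.sqrt_le_one.2 ?_
        rw [mul_div_assoc', div_le_one (by linarith), ← pow_succ]
        exact hcube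
      linarith
  · intro hN
    have hN2 : C₂ * (m * Real.log m) ≤ min (n : ℝ) (ρ / γ) :=
      (mul_le_mul_of_nonneg_right c2 (by positivity)).trans hN
    obtain ⟨-, d1, d2, d3, d4⟩ := h₂ m _ (c2.trans hCm) hN2
    set N := min (n : ℝ) (ρ / γ)
    set l := Real.log N
    have hl6 : 6 ≤ l := (le_max_right _ _).trans d3
    have hlam6 : 6 ≤ N / m := (le_max_right _ _).trans d2
    refine h₁ m n d γ ρ β T α c r hγ hT hβb hr hc.le ((le_max_left _ _).trans d1) hd
      ((le_max_left _ _).trans d2) ((le_max_left _ _).trans d3) ?_ ?_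
    · have h5 : l ≤ 1 / (32 * c ^ 2) * (N / m) :=
        d4.trans (mul_le_mul_of_nonneg_right (min_le_left _ _) (by linarith))
      rwa [one_div_mul_eq_div, le_div_iff₀' (by positivity)] at h5
    · have h5 : √(l / (N / m)) ≤ (c ^ 2 - 1) / (3 * c ^ 3) := by
        rw [Real.sqrt_le_left (by positivity), div_le_iff₀ (by linarith)]
        exact d4.trans (mul_le_mul_of_nonneg_right (min_le_right _ _) (by linarith))
      calc 3 * c ^ 3 * l * √(l / (N / m)) ≤ 3 * c ^ 3 * l * ((c ^ 2 - 1) / (3 * c ^ 3)) := by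
            gcongr
        _ = (c ^ 2 - 1) * l := by field_simp
        _ ≤ _ := by linarith
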